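/- Let $(X,d)$ be a metric space with a Borel measure $\mu$ such that every ball $B(x,r)=\{y: d(x,y)<r\}$, $r>0$, has positive and finite measure and $\mu(B(x,2r))\le c_D\,\mu(B(x,r))$ for all $x\in X$, $r>0$, with a constant $c_D$. Functions on $X$ are $\mu$-measurable and finite almost everywhere, and functions that agree almost everywhere are identified. For $0<s<\infty$, a sequence $(g_k)_{k\in\mathbb Z}$ of nonnegative measurable functions is a fractional $s$-gradient of $u$ if, outside a $\mu$-null set, $|u(x)-u(y)|\le d(x,y)^s(g_k(x)+g_k(y))$ whenever $k\in\mathbb Z$ and $2^{-k-1}\le d(x,y)<2^{-k}$. Let $$\|u\|_{\dot N^s_{p,q}(X)}=\inf\Big\|\big(\|g_k\|_{L^p(X)}\big)_{k\in\mathbb Z}\Big\|_{\ell^q},$$ where the infimum is over all fractional $s$-gradients of $u$, let $\dot N^s_{p,q}(X)$ be the set of functions $u$ for which this is finite, and let $N^s_{p,q}(X)=\dot N^s_{p,q}(X)\cap L^p(X)$ with $\|u\|_{N^s_{p,q}(X)}=\|u\|_{L^p(X)}+\|u\|_{\dot N^s_{p,q}(X)}$. A nonnegative measurable function $g$ is a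 $1$-gradient of $u$ if $|u(x)-u(y)|\le d(x,y)(g(x)+g(y))$ for all $x,y$ outside a $\mu$-null set. Let $\|u\|_{\dot M^{1,p}(X)}=\inf\|g\|_{L^p(X)}$ over all $1$-gradients $g$ of $u$, let $\dot M^{1,p}(X)$ be the set of functions $u$ for which this is finite, and let $M^{1,p}(X)=\dot M^{1,p}(X)\cap L^p(X)$ with $\|u\|_{M^{1,p}(X)}=\|u\|_{L^p(X)}+\|u\|_{\dot M^{1,p}(X)}$. For two such spaces $A_0,A_1$, $f\in A_0+A_1$ and $t>0$, let $K(f,t)=\inf\{\|f_0\|_{A_0}+t\|f_1\|_{A_1}: f=f_0+f_1,\ f_0\in A_0,\ f_1\in A_1\}$. For $0<s<1$ and $0<q\le\infty$ the space $(A_0,A_1)_{s,q}$ consists of the $f\in A_0+A_1$ for which $$\|f\|_{(A_0,A_1)_{s,q}}=\Big(\int_0^\infty\big(t^{-s}K(f,t)\big)^q\,\frac{dt}{t}\Big)^{1/q}$$ (replaced by $\sup_{t>0}t^{-s}K(f,t)$ if $q=\infty$) is finite. **Theorem.** Let $0<p<\infty$, $0<q\le\infty$ and $0<s<1$. Then $$\dot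 N^s_{p,q}(X)=\big(L^p(X),\dot M^{1,p}(X)\big)_{s,q}\qquad\text{and}\qquad N^s_{p,q}(X)=\big(L^p(X),M^{1,p}(X)\big)_{s,q},$$ with equivalent quasi-(semi)norms; that is, in each case the two spaces are equal as sets and there is a constant $C>0$ such that each of the two quasi-(semi)norms is at most $C$ times the other on that set. -/

import Mathlib

open MeasureTheory Set
open scoped ENNReal NNReal

noncomputable section

namespace HajlaszBesov

/-! ### Real interpolation

A quasi-seminormed space `A₀ ⊆ A` inside an ambient vector space `A` is represented by its extended
quasi-seminorm `N₀ : A → [0,∞]`, with `N₀ f = ∞` exactly when `f ∉ A₀`. -/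

section Interpolation

variable {A : Type*} [AddCommGroup A]

/-- The subspace on which an extended quasi-seminorm is finite. -/
def finiteSpace (N : A → ℝ≥0∞) : Set A := {f | N f < ∞}

/-- The `K`-functional `K(f,t;A₀,A₁) = inf {‖f₀‖_{A₀} + t ‖f₁‖_{A₁} : f = f₀ + f₁}`.
For `t > 0`, decompositions with `f₀ ∉ A₀` or `f₁ ∉ A₁` contribute `∞`. -/
def KFunctional (N₀ N₁ : A → ℝ≥0∞) (f : A) (t : ℝ) : ℝ≥0∞ :=
  ⨅ (f₀ : A) (f₁ : A) (_ : f = f₀ + f₁), N₀ f₀ + ENNReal.ofReal t * N₁ f₁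

/-- The quasi-seminorm of `(A₀,A₁)_{s,q}`:
`(∫_0^∞ (t^{-s} K(f,t))^q dt/t)^{1/q}` if `q < ∞`, and `sup_{t>0} t^{-s} K(f,t)` if `q = ∞`. -/
def interpNorm (N₀ N₁ : A → ℝ≥0∞) (s : ℝ) (q : ℝ≥0∞) (f : A) : ℝ≥0∞ :=
  if q = ∞ then
    ⨆ (t : ℝ) (_ : 0 < t), ENNReal.ofReal (t ^ (-s)) * KFunctional N₀ N₁ f t
  else
    (∫⁻ t in Ioi (0 : ℝ),
      (ENNReal.ofReal (t ^ (-s)) * KFunctional N₀ N₁ f t) ^ q.toReal * ENNReal.ofReal (1 / t))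
        ^ (1 / q.toReal)

/-- The real interpolation space `(A₀,A₁)_{s,q}`: the elements `f` of `A₀ + A₁` with finite
interpolation norm. -/
def interpSpace (N₀ N₁ : A → ℝ≥0∞) (s : ℝ) (q : ℝ≥0∞) : Set A :=
  {f | (∃ f₀ ∈ finiteSpace N₀, ∃ f₁ ∈ finiteSpace N₁, f = f₀ + f₁) ∧
    interpNorm N₀ N₁ s q f < ∞}

end Interpolation

/-! ### Function spaces on a metric measure space

The ambient vector space is `X →ₘ[μ] ℝ`, the `μ`-measurable, almost everywhere finite functions,
identified when they agree almost everywhere. -/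

section Spaces

variable {X : Type*} [MetricSpace X] [MeasurableSpace X]

/-- `μ` is doubling, and every ball has positive and finite measure. -/
structure IsDoubling (μ : Measure X) : Prop where
  ball_pos : ∀ (x : X) (r : ℝ), 0 < r → 0 < μ (Metric.ball x r)
  ball_lt_top : ∀ (x : X) (r : ℝ), 0 < r → μ (Metric.ball x r) < ∞
  doubling : ∃ c : ℝ≥0, ∀ (x : X) (r : ℝ), 0 < r →
    μ (Metric.ball x (2 * r)) ≤ c * μ (Metric.ball x r)

/-- The sequence `(g_k)`, `k ∈ ℤ`, is a fractional `s`-gradient of `u`. -/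
def IsFractionalGradient (μ : Measure X) (s : ℝ) (u : X → ℝ) (g : ℤ → X → ℝ≥0∞) : Prop :=
  (∀ k, Measurable (g k)) ∧
  ∃ E : Set X, μ E = 0 ∧ ∀ k : ℤ, ∀ x ∉ E, ∀ y ∉ E,
    (2 : ℝ) ^ (-k - 1) ≤ dist x y → dist x y < (2 : ℝ) ^ (-k) →
      ‖u x - u y‖ₑ ≤ edist x y ^ s * (g k x + g k y)

/-- `g` is an `s`-gradient of `u`. -/
def IsGradient (μ : Measure X) (s : ℝ) (u : X → ℝ) (g : X → ℝ≥0∞) : Prop :=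
  Measurable g ∧
  ∃ E : Set X, μ E = 0 ∧ ∀ x ∉ E, ∀ y ∉ E, ‖u x - u y‖ₑ ≤ edist x y ^ s * (g x + g y)

/-- The `ℓ^q(ℤ)` quasi-norm of a sequence in `[0,∞]`. -/
def seqNorm (q : ℝ≥0∞) (a : ℤ → ℝ≥0∞) : ℝ≥0∞ :=
  if q = ∞ then ⨆ k, a k else (∑' k, a k ^ q.toReal) ^ (1 / q.toReal)

variable (μ : Measure X)

/-- The `L^p(X)` quasi-norm. -/
def lpNorm (p : ℝ≥0∞) (u : X →ₘ[μ] ℝ) : ℝ≥0∞ := eLpNorm u p μ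

/-- The quasi-seminorm of the homogeneous Hajłasz–Besov space `Ṅ^s_{p,q}(X)`. -/
def homBesovNorm (s : ℝ) (p q : ℝ≥0∞) (u : X →ₘ[μ] ℝ) : ℝ≥0∞ :=
  ⨅ (g : ℤ → X → ℝ≥0∞) (_ : IsFractionalGradient μ s u g), seqNorm q (fun k => eLpNorm (g k) p μ)

/-- The quasi-norm of the Hajłasz–Besov space `N^s_{p,q}(X) = Ṅ^s_{p,q}(X) ∩ L^p(X)`. -/
def besovNorm (s : ℝ) (p q : ℝ≥0∞) (u : X →ₘ[μ] ℝ) : ℝ≥0∞ :=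
  lpNorm μ p u + homBesovNorm μ s p q u

/-- The quasi-seminorm of the homogeneous Hajłasz space `Ṁ^{s,p}(X)`. -/
def homHajlaszNorm (s : ℝ) (p : ℝ≥0∞) (u : X →ₘ[μ] ℝ) : ℝ≥0∞ :=
  ⨅ (g : X → ℝ≥0∞) (_ : IsGradient μ s u g), eLpNorm g p μ

/-- The quasi-norm of the Hajłasz space `M^{s,p}(X) = Ṁ^{s,p}(X) ∩ L^p(X)`. -/
def hajlaszNorm (s : ℝ) (p : ℝ≥0∞) (u : X →ₘ[μ] ℝ) : ℝ≥0∞ :=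
  lpNorm μ p u + homHajlaszNorm μ s p u

/-- The homogeneous Hajłasz–Besov space `Ṅ^s_{p,q}(X)`. -/
def homBesovSpace (s : ℝ) (p q : ℝ≥0∞) : Set (X →ₘ[μ] ℝ) :=
  finiteSpace (homBesovNorm μ s p q)

/-- The Hajłasz–Besov space `N^s_{p,q}(X) = Ṅ^s_{p,q}(X) ∩ L^p(X)`. -/
def besovSpace (s : ℝ) (p q : ℝ≥0∞) : Set (X →ₘ[μ] ℝ) :=
  homBesovSpace μ s p q ∩ finiteSpace (lpNorm μ p)

end Spaces

end HajlaszBesov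

end

/-!
By monotonicity of the `K`-functional, the interpolation norm is equivalent to the `ℓ^q` norm of the
dyadic sequence `2^{ks} K(u, 2^{-k})` (`exists_seqNorm_dyadicK_le`, `exists_interpNorm_le`). All the
comparisons are inequalities between extended norms, so they give equality of the spaces as well.

*Interpolation space into Besov space.* If `u = f₀ + f₁` is a nearly optimal decomposition for
`t = 2^{-k}` and `h` is a `1`-gradient of `f₁`, then at distances comparable to `2^{-k}` a multiple
of `2^{ks} (|f₀| + 2^{-k} h)` is an admissible `k`-th term of a fractional gradient
(`isFractionalGradient_of_decomposition`).

*Besov space into interpolation space.* Let `(g_j)` be a fractional gradient of `u`, and let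
`r = 2^{-k}`. At distances below `8r` the oscillation of `u` is controlled by
`G = sup_{j ≥ k-3} 2^{-js} g_j`. Choose a maximal `r`-separated set and, in the ball of radius `r/2` about each of its points, a point where
`G^p` is at most its mean over that ball. Averaging the values of `u` at the chosen points with a
Lipschitz partition of unity gives a function `v` with `‖u - v‖_p ≲ ‖G‖_p` whose Lipschitz constant
below scale `r` is `r⁻¹ H` with `‖H‖_p ≲ ‖G‖_p` (`IsDoubling.exists_lipschitz_approx`). Since point
values replace integral means, `u` need not be locally integrable and every `p > 0` is allowed.
Above scale `r`, the difference quotients of `v` are controlled by `r⁻¹ (G + H)` and by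
`sup_{j ≤ k} 2^{(j+1)(1-s)} g_j` (`isGradient_of_approx`). Hence `2^{ks} K(u, 2^{-k})` is at most a
geometric convolution of the sequence `‖g_j‖_p` (`IsDoubling.exists_dyadicK_le`), and such
convolutions are bounded on `ℓ^q` for every `q > 0` (`exists_seqNorm_iSup_geomWeight_le`).

*Inhomogeneous spaces.* Replacing `Ṁ^{1,p}` by `M^{1,p}` changes `K(u, t)` by at most a multiple of
`min(1, t) ‖u‖_p` (`exists_dyadicK_hajlaszNorm_le`), whose contribution to the interpolation norm is
comparable to `‖u‖_p` because `0 < s < 1`; conversely `K(u, 1)` dominates `‖u‖_p`.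
-/

noncomputable section

namespace HajlaszBesov

/-! ### Sequence norms and geometric weights -/

section Sequences

variable {q : ℝ≥0∞}

lemma two_rpow_add (a b : ℝ) : (2 : ℝ≥0∞) ^ (a + b) = 2 ^ a * 2 ^ b :=
  ENNReal.rpow_add a b two_ne_zero ENNReal.ofNat_ne_top

lemma two_rpow_ne_top (a : ℝ) : (2 : ℝ≥0∞) ^ a ≠ ∞ :=
  ENNReal.rpow_ne_top_of_ne_zero two_ne_zero ENNReal.ofNat_ne_top

lemma two_rpow_ne_zero (a : ℝ) : (2 : ℝ≥0∞) ^ a ≠ 0 := by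
  simp [ENNReal.rpow_eq_zero_iff]

lemma two_rpow_mono {a b : ℝ} (h : a ≤ b) : (2 : ℝ≥0∞) ^ a ≤ 2 ^ b :=
  ENNReal.rpow_le_rpow_of_exponent_le one_le_two h

lemma ofReal_two_zpow (k : ℤ) : ENNReal.ofReal ((2 : ℝ) ^ k) = (2 : ℝ≥0∞) ^ (k : ℝ) := by
  rw [← Real.rpow_intCast, ← ENNReal.ofReal_rpow_of_pos two_pos]
  simp

lemma seqNorm_of_ne_top (hq : q ≠ ∞) (a : ℤ → ℝ≥0∞) :
    seqNorm q a = (∑' k, a k ^ q.toReal) ^ (1 / q.toReal) := if_neg hq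

lemma seqNorm_top (a : ℤ → ℝ≥0∞) : seqNorm ∞ a = ⨆ k, a k := if_pos rfl

lemma seqNorm_mono {a b : ℤ → ℝ≥0∞} (h : ∀ k, a k ≤ b k) : seqNorm q a ≤ seqNorm q b := by
  unfold seqNorm
  split_ifs
  · exact iSup_mono h
  · gcongr with k
    exact h k

lemma le_seqNorm (hq : 0 < q) (a : ℤ → ℝ≥0∞) (k : ℤ) : a k ≤ seqNorm q a := by
  by_cases hq' : q = ∞
  · subst hq'
    rw [seqNorm_top]
    exact le_iSup a k
  · have hQ : 0 < q.toReal := ENNReal.toReal_pos hq.ne' hq'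
    rw [seqNorm_of_ne_top hq', one_div, ENNReal.le_rpow_inv_iff hQ]
    exact ENNReal.le_tsum k

lemma seqNorm_const_mul (hq : 0 < q) (c : ℝ≥0∞) (a : ℤ → ℝ≥0∞) :
    seqNorm q (fun k => c * a k) = c * seqNorm q a := by
  by_cases hq' : q = ∞
  · subst hq'
    simp only [seqNorm_top, ENNReal.mul_iSup]
  · have hQ : 0 < q.toReal := ENNReal.toReal_pos hq.ne' hq'
    simp only [seqNorm_of_ne_top hq']
    simp_rw [ENNReal.mul_rpow_of_nonneg _ _ hQ.le]
    rw [ENNReal.tsum_mul_left, ENNReal.mul_rpow_of_nonneg _ _ (by positivity), ← ENNReal.rpow_mul,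
      mul_one_div_cancel hQ.ne', ENNReal.rpow_one]

/-- `(x + y)^r ≤ 2^r (x^r + y^r)` for every exponent `r ≥ 0`. -/
lemma add_rpow_le_two_rpow_mul {r : ℝ} (hr : 0 ≤ r) (x y : ℝ≥0∞) :
    (x + y) ^ r ≤ 2 ^ r * (x ^ r + y ^ r) := by
  have h : x + y ≤ 2 * max x y := by
    rw [two_mul]
    exact add_le_add (le_max_left _ _) (le_max_right _ _)
  calc (x + y) ^ r ≤ (2 * max x y) ^ r := by gcongr
    _ = 2 ^ r * (max x y) ^ r := ENNReal.mul_rpow_of_nonneg _ _ hr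
    _ ≤ 2 ^ r * (x ^ r + y ^ r) := by
      gcongr
      rcases max_choice x y with h | h <;> rw [h]
      · exact le_self_add
      · exact le_add_self

lemma exists_seqNorm_add_le (hq : 0 < q) : ∃ C : ℝ≥0, 0 < C ∧ ∀ a b : ℤ → ℝ≥0∞,
    seqNorm q (fun k => a k + b k) ≤ C * (seqNorm q a + seqNorm q b) := by
  by_cases hq' : q = ∞
  · subst hq'
    refine ⟨1, one_pos, fun a b => ?_⟩
    simp only [seqNorm_top, ENNReal.coe_one, one_mul]
    exact iSup_le fun k => add_le_add (le_iSup a k) (le_iSup b k)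
  · have hQ : 0 < q.toReal := ENNReal.toReal_pos hq.ne' hq'
    set Q := q.toReal
    refine ⟨2 * 2 ^ (1 / Q), by positivity, fun a b => ?_⟩
    simp only [seqNorm_of_ne_top hq']
    calc (∑' k, (a k + b k) ^ Q) ^ (1 / Q)
        ≤ (2 ^ Q * (∑' k, a k ^ Q + ∑' k, b k ^ Q)) ^ (1 / Q) := by
          rw [← ENNReal.tsum_add, ← ENNReal.tsum_mul_left]
          gcongr with k
          exact add_rpow_le_two_rpow_mul hQ.le _ _
      _ = 2 * (∑' k, a k ^ Q + ∑' k, b k ^ Q) ^ (1 / Q) := by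
          rw [ENNReal.mul_rpow_of_nonneg _ _ (by positivity), ← ENNReal.rpow_mul,
            mul_one_div_cancel hQ.ne', ENNReal.rpow_one]
      _ ≤ 2 * (2 ^ (1 / Q) * ((∑' k, a k ^ Q) ^ (1 / Q) + (∑' k, b k ^ Q) ^ (1 / Q))) := by
          gcongr
          exact add_rpow_le_two_rpow_mul (by positivity) _ _
      _ = _ := by
          rw [← mul_assoc]
          congr 1
          rw [ENNReal.coe_mul, ENNReal.coe_rpow_of_nonneg _ (by positivity)]
          rfl

/-- The two-sided geometric weight `2^{-ε|m|}`, `m ∈ ℤ`. -/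
def geomWeight (ε : ℝ) (m : ℤ) : ℝ≥0∞ := 2 ^ (-ε * |(m : ℝ)|)

lemma geomWeight_rpow (ε r : ℝ) (m : ℤ) : geomWeight ε m ^ r = geomWeight (ε * r) m := by
  rw [geomWeight, geomWeight, ← ENNReal.rpow_mul]
  congr 1
  ring

lemma geomWeight_add (ε δ : ℝ) (m : ℤ) :
    geomWeight (ε + δ) m = geomWeight ε m * geomWeight δ m := by
  rw [geomWeight, geomWeight, geomWeight, ← two_rpow_add]
  congr 1
  ring

lemma tsum_geomWeight_ne_top {ε : ℝ} (hε : 0 < ε) : ∑' m, geomWeight ε m ≠ ∞ := by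
  have hlt : (2 : ℝ≥0∞) ^ (-ε) < 1 :=
    ENNReal.rpow_lt_one_of_one_lt_of_neg ENNReal.one_lt_two (by linarith)
  have key : ∑' n : ℕ, ((2 : ℝ≥0∞) ^ (-ε)) ^ n ≠ ∞ := by
    rw [ENNReal.tsum_geometric]
    exact ENNReal.inv_ne_top.2 (tsub_pos_iff_lt.2 hlt).ne'
  have hpow : ∀ n : ℕ, geomWeight ε n = ((2 : ℝ≥0∞) ^ (-ε)) ^ n := fun n => by
    rw [geomWeight, ← ENNReal.rpow_natCast, ← ENNReal.rpow_mul]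
    simp
  have hneg : ∀ n : ℕ, geomWeight ε (-(n + 1 : ℤ)) ≤ ((2 : ℝ≥0∞) ^ (-ε)) ^ n := fun n => by
    rw [← hpow]
    refine two_rpow_mono ?_
    push_cast
    rw [abs_neg, abs_of_nonneg (by positivity), abs_of_nonneg (by positivity)]
    nlinarith
  rw [tsum_of_nat_of_neg_add_one ENNReal.summable ENNReal.summable]
  refine ENNReal.add_ne_top.2 ⟨?_, ?_⟩
  · simpa only [hpow] using key
  · exact ne_top_of_le_ne_top key (ENNReal.tsum_le_tsum hneg)

/-- Convolution with a geometric weight, in its supremum form, is bounded on `ℓ^q` for every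
exponent: the `q`-th power of a supremum is at most the sum of the `q`-th powers. -/
lemma exists_seqNorm_iSup_geomWeight_le (hq : 0 < q) {ε : ℝ} (hε : 0 < ε) :
    ∃ C : ℝ≥0, 0 < C ∧ ∀ a : ℤ → ℝ≥0∞,
      seqNorm q (fun k => ⨆ j, geomWeight ε (k - j) * a j) ≤ C * seqNorm q a := by
  by_cases hq' : q = ∞
  · subst hq'
    refine ⟨1, one_pos, fun a => ?_⟩
    simp only [seqNorm_top, ENNReal.coe_one, one_mul]
    refine iSup_le fun k => iSup_le fun j => ?_
    refine le_trans ?_ (le_iSup a j)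
    refine mul_le_of_le_one_left' ?_
    have : geomWeight ε (k - j) ≤ 2 ^ (0 : ℝ) := two_rpow_mono (by
      have := abs_nonneg (((k - j : ℤ) : ℝ))
      nlinarith)
    simpa using this
  · have hQ : 0 < q.toReal := ENNReal.toReal_pos hq.ne' hq'
    set Q := q.toReal with hQdef
    have hS : ∑' m, geomWeight (ε * Q) m ≠ ∞ := tsum_geomWeight_ne_top (by positivity)
    have hC : (∑' m, geomWeight (ε * Q) m) ^ (1 / Q) ≠ ∞ :=
      ENNReal.rpow_ne_top_of_nonneg (by positivity) hS
    refine ⟨((∑' m, geomWeight (ε * Q) m) ^ (1 / Q)).toNNReal + 1, by positivity, fun a => ?_⟩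
    rw [ENNReal.coe_add, ENNReal.coe_toNNReal hC]
    refine le_trans ?_ (mul_le_mul_left le_self_add _)
    simp only [seqNorm_of_ne_top hq', ← hQdef]
    rw [← ENNReal.mul_rpow_of_nonneg _ _ (by positivity)]
    gcongr
    calc ∑' k, (⨆ j, geomWeight ε (k - j) * a j) ^ Q
        ≤ ∑' k, ∑' j, geomWeight (ε * Q) (k - j) * a j ^ Q := by
          gcongr with k
          rw [← ENNReal.le_rpow_inv_iff hQ]
          refine iSup_le fun j => ?_
          rw [ENNReal.le_rpow_inv_iff hQ, ENNReal.mul_rpow_of_nonneg _ _ hQ.le,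
            geomWeight_rpow]
          exact ENNReal.le_tsum (f := fun j => geomWeight (ε * Q) (k - j) * a j ^ Q) j
      _ = ∑' j, ∑' k, geomWeight (ε * Q) (k - j) * a j ^ Q := ENNReal.tsum_comm
      _ = ∑' j, (∑' m, geomWeight (ε * Q) m) * a j ^ Q := by
          congr 1 with j
          rw [ENNReal.tsum_mul_right]
          congr 1
          exact (Equiv.subRight j).tsum_eq (geomWeight (ε * Q))
      _ = (∑' m, geomWeight (ε * Q) m) * ∑' j, a j ^ Q := ENNReal.tsum_mul_left

/-- A geometrically weighted `ℓ^P` sum is controlled by a geometrically weighted supremum. -/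
lemma exists_tsum_geomWeight_rpow_le_iSup {P ε : ℝ} (hP : 0 < P) (hε : 0 < ε) :
    ∃ C : ℝ≥0, 0 < C ∧ ∀ (a : ℤ → ℝ≥0∞) (k : ℤ),
      (∑' j, (geomWeight (2 * ε) (k - j) * a j) ^ P) ^ (1 / P) ≤
        C * ⨆ j, geomWeight ε (k - j) * a j := by
  have hS : ∑' m, geomWeight (ε * P) m ≠ ∞ := tsum_geomWeight_ne_top (by positivity)
  have hC : (∑' m, geomWeight (ε * P) m) ^ (1 / P) ≠ ∞ :=
    ENNReal.rpow_ne_top_of_nonneg (by positivity) hS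
  refine ⟨((∑' m, geomWeight (ε * P) m) ^ (1 / P)).toNNReal + 1, by positivity, fun a k => ?_⟩
  rw [ENNReal.coe_add, ENNReal.coe_toNNReal hC]
  refine le_trans ?_ (mul_le_mul_left le_self_add _)
  set S := ⨆ j, geomWeight ε (k - j) * a j
  calc (∑' j, (geomWeight (2 * ε) (k - j) * a j) ^ P) ^ (1 / P)
      ≤ (∑' j, geomWeight (ε * P) (k - j) * S ^ P) ^ (1 / P) := by
        gcongr with j
        rw [two_mul, geomWeight_add, mul_assoc, ENNReal.mul_rpow_of_nonneg _ _ hP.le,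
          geomWeight_rpow]
        gcongr
        exact le_iSup (fun j => geomWeight ε (k - j) * a j) j
    _ = (∑' m, geomWeight (ε * P) m) ^ (1 / P) * S := by
        rw [ENNReal.tsum_mul_right, ENNReal.mul_rpow_of_nonneg _ _ (by positivity),
          ← ENNReal.rpow_mul, mul_one_div_cancel hP.ne', ENNReal.rpow_one]
        congr 2
        exact (Equiv.subLeft k).tsum_eq (geomWeight (ε * P))

lemma exists_seqNorm_geomWeight_le (hq : 0 < q) {ε : ℝ} (hε : 0 < ε) :
    ∃ C : ℝ≥0, 0 < C ∧ seqNorm q (geomWeight ε) ≤ C := by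
  by_cases hq' : q = ∞
  · subst hq'
    refine ⟨1, one_pos, ?_⟩
    rw [seqNorm_top]
    refine iSup_le fun k => ?_
    have : geomWeight ε k ≤ 2 ^ (0 : ℝ) := two_rpow_mono (by
      have := abs_nonneg (k : ℝ)
      nlinarith)
    simpa using this
  · have hQ : 0 < q.toReal := ENNReal.toReal_pos hq.ne' hq'
    have hC : (∑' m, geomWeight (ε * q.toReal) m) ^ (1 / q.toReal) ≠ ∞ :=
      ENNReal.rpow_ne_top_of_nonneg (by positivity) (tsum_geomWeight_ne_top (by positivity))
    refine ⟨((∑' m, geomWeight (ε * q.toReal) m) ^ (1 / q.toReal)).toNNReal + 1,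
      by positivity, ?_⟩
    rw [ENNReal.coe_add, ENNReal.coe_toNNReal hC, seqNorm_of_ne_top hq']
    simp only [geomWeight_rpow]
    exact le_self_add

end Sequences

/-! ### Discretization of the interpolation norm -/

section Discretization

variable {A : Type*} [AddCommGroup A] {N₀ N₁ : A → ℝ≥0∞} {q : ℝ≥0∞}

/-- The sequence `2^{ks} K(f, 2^{-k})`, `k ∈ ℤ`. -/
def dyadicK (N₀ N₁ : A → ℝ≥0∞) (s : ℝ) (f : A) (k : ℤ) : ℝ≥0∞ :=
  2 ^ (k * s) * KFunctional N₀ N₁ f ((2 : ℝ) ^ (-k))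

lemma KFunctional_mono (f : A) {t t' : ℝ} (h : t ≤ t') :
    KFunctional N₀ N₁ f t ≤ KFunctional N₀ N₁ f t' := by
  unfold KFunctional
  gcongr

lemma ofReal_rpow_neg_bounds {s t : ℝ} (hs : 0 < s) {n : ℤ} (h₁ : (2 : ℝ) ^ n ≤ t)
    (h₂ : t ≤ (2 : ℝ) ^ (n + 1)) :
    (2 : ℝ≥0∞) ^ (-(n + 1 : ℝ) * s) ≤ ENNReal.ofReal (t ^ (-s)) ∧
      ENNReal.ofReal (t ^ (-s)) ≤ 2 ^ (-(n : ℝ) * s) := by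
  have ht : 0 < t := lt_of_lt_of_le (by positivity) h₁
  have h₁' := ENNReal.ofReal_le_ofReal h₁
  have h₂' := ENNReal.ofReal_le_ofReal h₂
  rw [ofReal_two_zpow] at h₁' h₂'
  rw [← ENNReal.ofReal_rpow_of_pos ht, ENNReal.rpow_neg, neg_mul, neg_mul, ENNReal.rpow_neg,
    ENNReal.rpow_neg, ENNReal.rpow_mul, ENNReal.rpow_mul]
  push_cast at h₂'
  constructor
  · gcongr
  · gcongr

/-- On the dyadic interval `[2^n, 2^{n+1}]` the weighted `K`-functional is bounded below by the
term of index `-n` at its left endpoint. -/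
lemma dyadicK_le {s t : ℝ} (hs : 0 < s) (f : A) {n : ℤ} (h₁ : (2 : ℝ) ^ n ≤ t)
    (h₂ : t ≤ (2 : ℝ) ^ (n + 1)) :
    2 ^ (-s) * dyadicK N₀ N₁ s f (-n) ≤ ENNReal.ofReal (t ^ (-s)) * KFunctional N₀ N₁ f t := by
  rw [dyadicK, ← mul_assoc, ← two_rpow_add, neg_neg]
  refine mul_le_mul' ?_ (KFunctional_mono f h₁)
  refine le_trans (le_of_eq ?_) (ofReal_rpow_neg_bounds hs h₁ h₂).1
  congr 1
  push_cast
  ring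

/-- On the dyadic interval `[2^n, 2^{n+1}]` the weighted `K`-functional is bounded above by the
term of index `-(n + 1)` at its right endpoint. -/
lemma le_dyadicK {s t : ℝ} (hs : 0 < s) (f : A) {n : ℤ} (h₁ : (2 : ℝ) ^ n ≤ t)
    (h₂ : t ≤ (2 : ℝ) ^ (n + 1)) :
    ENNReal.ofReal (t ^ (-s)) * KFunctional N₀ N₁ f t ≤
      2 ^ s * dyadicK N₀ N₁ s f (-(n + 1)) := by
  rw [dyadicK, ← mul_assoc, ← two_rpow_add, neg_neg]
  refine mul_le_mul' ?_ (KFunctional_mono f h₂)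
  refine le_trans (ofReal_rpow_neg_bounds hs h₁ h₂).2 (le_of_eq ?_)
  congr 1
  push_cast
  ring

lemma lintegral_Ioi_eq_tsum_dyadic (F : ℝ → ℝ≥0∞) :
    ∫⁻ t in Ioi (0 : ℝ), F t = ∑' n : ℤ, ∫⁻ t in Ico ((2 : ℝ) ^ n) (2 ^ (n + 1)), F t := by
  have h : Ioi (0 : ℝ) = ⋃ n : ℤ, Ico ((2 : ℝ) ^ n) (2 ^ (n + 1)) := by
    ext t
    simp only [mem_Ioi, mem_iUnion]
    refine ⟨fun ht => exists_mem_Ico_zpow ht one_lt_two, fun ⟨n, hn⟩ => ?_⟩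
    exact lt_of_lt_of_le (by positivity) hn.1
  rw [h, lintegral_iUnion (fun _ => measurableSet_Ico)]
  intro m n hmn
  rw [Function.onFun, Set.disjoint_left]
  intro t ht ht'
  apply hmn
  have h₁ : m < n + 1 := (zpow_lt_zpow_iff_right₀ one_lt_two).1 (ht.1.trans_lt ht'.2)
  have h₂ : n < m + 1 := (zpow_lt_zpow_iff_right₀ one_lt_two).1 (ht'.1.trans_lt ht.2)
  omega

lemma volume_dyadic (n : ℤ) :
    volume (Ico ((2 : ℝ) ^ n) (2 ^ (n + 1))) = ENNReal.ofReal (2 ^ n) := by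
  rw [Real.volume_Ico, zpow_add_one₀ two_ne_zero]
  congr 1
  ring

lemma seqNorm_comp_neg (a : ℤ → ℝ≥0∞) : seqNorm q (fun k => a (-k)) = seqNorm q a := by
  by_cases hq : q = ∞
  · subst hq
    simp only [seqNorm_top]
    exact (Equiv.neg ℤ).iSup_comp (g := a)
  · simp only [seqNorm_of_ne_top hq]
    congr 1
    exact (Equiv.neg ℤ).tsum_eq fun k => a k ^ q.toReal

lemma seqNorm_comp_neg_add_one (a : ℤ → ℝ≥0∞) :
    seqNorm q (fun k => a (-(k + 1))) = seqNorm q a := by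
  rw [← seqNorm_comp_neg a]
  by_cases hq : q = ∞
  · subst hq
    simp only [seqNorm_top]
    exact (Equiv.addRight (1 : ℤ)).iSup_comp (g := fun k => a (-k))
  · simp only [seqNorm_of_ne_top hq]
    congr 1
    exact (Equiv.addRight (1 : ℤ)).tsum_eq fun k => a (-k) ^ q.toReal

/-- The continuous interpolation norm dominates the dyadic one: `K(f, ·)` is nondecreasing, and
`dt/t` gives mass at least `1/2` to every dyadic interval. -/
lemma exists_seqNorm_dyadicK_le (hq : 0 < q) {s : ℝ} (hs : 0 < s) :
    ∃ C : ℝ≥0, 0 < C ∧ ∀ f : A, seqNorm q (dyadicK N₀ N₁ s f) ≤ C * interpNorm N₀ N₁ s q f := by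
  suffices h : ∃ C : ℝ≥0, 0 < C ∧ ∀ f : A,
      seqNorm q (fun n => 2 ^ (-s) * dyadicK N₀ N₁ s f (-n)) ≤ C * interpNorm N₀ N₁ s q f by
    obtain ⟨C, hC, h⟩ := h
    refine ⟨2 ^ s * C, by positivity, fun f => ?_⟩
    have h' := h f
    rw [seqNorm_const_mul hq, seqNorm_comp_neg] at h'
    calc seqNorm q (dyadicK N₀ N₁ s f)
        = 2 ^ s * (2 ^ (-s) * seqNorm q (dyadicK N₀ N₁ s f)) := by
          rw [← mul_assoc, ← two_rpow_add]
          simp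
      _ ≤ 2 ^ s * (C * interpNorm N₀ N₁ s q f) := by gcongr
      _ = _ := by
          rw [ENNReal.coe_mul, ENNReal.coe_rpow_of_nonneg _ hs.le, mul_assoc]
          rfl
  by_cases hq' : q = ∞
  · subst hq'
    refine ⟨1, one_pos, fun f => ?_⟩
    rw [seqNorm_top, interpNorm, if_pos rfl, ENNReal.coe_one, one_mul]
    refine iSup_le fun n => ?_
    refine (dyadicK_le hs f le_rfl (zpow_le_zpow_right₀ one_le_two (by omega))).trans ?_
    exact le_iSup₂ (f := fun (t : ℝ) (_ : 0 < t) =>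
      ENNReal.ofReal (t ^ (-s)) * KFunctional N₀ N₁ f t) ((2 : ℝ) ^ n) (by positivity)
  · have hQ : 0 < q.toReal := ENNReal.toReal_pos hq.ne' hq'
    refine ⟨2 ^ (1 / q.toReal), by positivity, fun f => ?_⟩
    rw [seqNorm_of_ne_top hq', interpNorm, if_neg hq', lintegral_Ioi_eq_tsum_dyadic]
    set Q := q.toReal
    rw [ENNReal.coe_rpow_of_nonneg _ (by positivity),
      ← ENNReal.mul_rpow_of_nonneg _ _ (by positivity), ← ENNReal.tsum_mul_left]
    gcongr with n
    have hvol : ENNReal.ofReal (1 / 2 ^ (n + 1)) * ENNReal.ofReal (2 ^ n) = 2⁻¹ := by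
      rw [← ENNReal.ofReal_mul (by positivity), zpow_add_one₀ two_ne_zero]
      have : (1 / ((2 : ℝ) ^ n * 2) * 2 ^ n) = 2⁻¹ := by field_simp
      rw [this, ENNReal.ofReal_inv_of_pos two_pos]
      simp
    calc (2 ^ (-s) * dyadicK N₀ N₁ s f (-n)) ^ Q
        = 2 * ∫⁻ _ in Ico ((2 : ℝ) ^ n) (2 ^ (n + 1)),
            (2 ^ (-s) * dyadicK N₀ N₁ s f (-n)) ^ Q * ENNReal.ofReal (1 / 2 ^ (n + 1)) := by
          rw [setLIntegral_const, volume_dyadic, mul_assoc, hvol, mul_left_comm,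
            ENNReal.mul_inv_cancel two_ne_zero ENNReal.ofNat_ne_top, mul_one]
      _ ≤ _ := by
          rw [ENNReal.coe_ofNat]
          gcongr 2 * ?_
          refine setLIntegral_mono' measurableSet_Ico fun t ht => ?_
          have ht0 : 0 < t := lt_of_lt_of_le (by positivity) ht.1
          have := dyadicK_le (N₀ := N₀) (N₁ := N₁) hs f ht.1 ht.2.le
          have := ht.2.le
          gcongr

/-- The dyadic interpolation norm dominates the continuous one: `dt/t` gives mass at most `1` to
every dyadic interval. -/
lemma exists_interpNorm_le (hq : 0 < q) {s : ℝ} (hs : 0 < s) :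
    ∃ C : ℝ≥0, 0 < C ∧ ∀ f : A, interpNorm N₀ N₁ s q f ≤ C * seqNorm q (dyadicK N₀ N₁ s f) := by
  refine ⟨2 ^ s, by positivity, fun f => ?_⟩
  rw [ENNReal.coe_rpow_of_nonneg _ hs.le, ENNReal.coe_ofNat,
    ← seqNorm_comp_neg_add_one (dyadicK N₀ N₁ s f), ← seqNorm_const_mul hq]
  by_cases hq' : q = ∞
  · subst hq'
    rw [seqNorm_top, interpNorm, if_pos rfl]
    refine iSup₂_le fun t ht => ?_
    obtain ⟨n, hn⟩ := exists_mem_Ico_zpow ht one_lt_two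
    exact (le_dyadicK hs f hn.1 hn.2.le).trans
      (le_iSup (fun n : ℤ => 2 ^ s * dyadicK N₀ N₁ s f (-(n + 1))) n)
  · have hQ : 0 < q.toReal := ENNReal.toReal_pos hq.ne' hq'
    rw [seqNorm_of_ne_top hq', interpNorm, if_neg hq', lintegral_Ioi_eq_tsum_dyadic]
    set Q := q.toReal
    gcongr with n
    have hvol : ENNReal.ofReal (1 / 2 ^ n) * ENNReal.ofReal (2 ^ n) = 1 := by
      rw [← ENNReal.ofReal_mul (by positivity), one_div_mul_cancel (by positivity),
        ENNReal.ofReal_one]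
    calc _ ≤ ∫⁻ _ in Ico ((2 : ℝ) ^ n) (2 ^ (n + 1)),
            (2 ^ s * dyadicK N₀ N₁ s f (-(n + 1))) ^ Q * ENNReal.ofReal (1 / 2 ^ n) := by
          refine setLIntegral_mono' measurableSet_Ico fun t ht => ?_
          have := le_dyadicK (N₀ := N₀) (N₁ := N₁) hs f ht.1 ht.2.le
          have := ht.1
          gcongr
      _ = _ := by rw [setLIntegral_const, volume_dyadic, mul_assoc, hvol, mul_one]

/-- An element of finite dyadic interpolation norm lies in `A₀ + A₁`, so that the interpolation
space is cut out by its norm alone. -/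
lemma interpSpace_eq (hq : 0 < q) {s : ℝ} (hs : 0 < s) :
    interpSpace N₀ N₁ s q = {f | interpNorm N₀ N₁ s q f < ∞} := by
  refine Subset.antisymm (fun f hf => hf.2) fun f hf => ⟨?_, hf⟩
  obtain ⟨C, -, h⟩ := exists_seqNorm_dyadicK_le (N₀ := N₀) (N₁ := N₁) hq hs
  have h₀ : dyadicK N₀ N₁ s f 0 < ∞ :=
    ((le_seqNorm hq _ 0).trans (h f)).trans_lt (ENNReal.mul_lt_top ENNReal.coe_lt_top hf)
  simp only [dyadicK, KFunctional, Int.cast_zero, zero_mul, ENNReal.rpow_zero, one_mul, neg_zero,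
    zpow_zero, ENNReal.ofReal_one, iInf_lt_iff] at h₀
  obtain ⟨f₀, f₁, hff, hlt⟩ := h₀
  rw [ENNReal.add_lt_top] at hlt
  exact ⟨f₀, hlt.1, f₁, hlt.2, hff⟩

end Discretization

/-! ### Partition-of-unity averages over a net -/

section Average

variable {X ι : Type*} [MetricSpace X]

/-- The Lipschitz bump at scale `r` centred at `z`: at least `1` on `B(z,r)`, and `0` outside
`B(z,2r)`. -/
def bump (r : ℝ) (z x : X) : ℝ := max 0 (2 - dist x z / r)

/-- The average of the values `c i`, attached to the points `z i`, with respect to the normalized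
bumps at scale `r`. -/
def bumpAverage (r : ℝ) (z : ι → X) (c : ι → ℝ) (x : X) : ℝ :=
  (∑ᶠ i, bump r (z i) x * c i) / ∑ᶠ i, bump r (z i) x

variable {r : ℝ} {z : ι → X} {c : ι → ℝ} {F : X → Finset ι}

lemma bump_nonneg (r : ℝ) (z x : X) : 0 ≤ bump r z x := le_max_left _ _

lemma dist_lt_of_bump_ne_zero (hr : 0 < r) {z x : X} (h : bump r z x ≠ 0) :
    dist x z < 2 * r := by
  by_contra! h'
  refine h (max_eq_left ?_)
  rw [sub_nonpos, le_div_iff₀ hr]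
  exact h'

lemma one_le_bump (hr : 0 < r) {z x : X} (h : dist x z < r) : 1 ≤ bump r z x := by
  refine le_trans ?_ (le_max_right _ _)
  have : dist x z / r < 1 := (div_lt_one hr).2 h
  linarith

lemma abs_bump_sub_le (hr : 0 < r) (z x y : X) :
    |bump r z x - bump r z y| ≤ dist x y / r := by
  refine (abs_max_sub_max_le_max _ _ _ _).trans (max_le (by simp; positivity) ?_)
  rw [sub_sub_sub_cancel_left, ← sub_div, abs_div, abs_of_pos hr]
  gcongr
  rw [dist_comm x y]
  exact abs_dist_sub_le y x z

/-- Near `x`, the bump average is a finite weighted mean over the indices in `F x`. -/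
lemma bumpAverage_eq (hr : 0 < r) (hF : ∀ x i, dist x (z i) < 3 * r → i ∈ F x) {x y : X}
    (hxy : dist x y < r) :
    bumpAverage r z c y =
      (∑ i ∈ F x, bump r (z i) y * c i) / ∑ i ∈ F x, bump r (z i) y := by
  have hmem : ∀ i, bump r (z i) y ≠ 0 → i ∈ F x := fun i hi => hF x i <| by
    have := dist_lt_of_bump_ne_zero hr hi
    have := dist_triangle x y (z i)
    linarith
  rw [bumpAverage, finsum_eq_sum_of_support_subset (s := F x),
    finsum_eq_sum_of_support_subset (s := F x)]
  · exact fun i hi => hmem i hi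
  · exact fun i hi => hmem i (left_ne_zero_of_mul hi)

lemma one_le_sum_bump (hr : 0 < r) (hF : ∀ x i, dist x (z i) < 3 * r → i ∈ F x)
    (hz : ∀ x, ∃ i, dist x (z i) < r) {x y : X} (hxy : dist x y < r) :
    1 ≤ ∑ i ∈ F x, bump r (z i) y := by
  obtain ⟨i, hi⟩ := hz y
  refine (one_le_bump hr hi).trans (Finset.single_le_sum (f := fun i => bump r (z i) y)
    (fun j _ => bump_nonneg _ _ _) (hF x i ?_))
  have := dist_triangle x y (z i)
  linarith

lemma abs_sub_bumpAverage_le (hr : 0 < r) (hF : ∀ x i, dist x (z i) < 3 * r → i ∈ F x)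
    (hz : ∀ x, ∃ i, dist x (z i) < r) {x : X} {a M : ℝ}
    (h : ∀ i, dist x (z i) < 2 * r → |a - c i| ≤ M) : |a - bumpAverage r z c x| ≤ M := by
  have hx : dist x x < r := by simpa using hr
  have h1 := one_le_sum_bump hr hF hz hx
  rw [bumpAverage_eq hr hF hx]
  set S := ∑ i ∈ F x, bump r (z i) x
  have hS : 0 < S := by linarith
  have : a - (∑ i ∈ F x, bump r (z i) x * c i) / S =
      (∑ i ∈ F x, bump r (z i) x * (a - c i)) / S := by
    simp_rw [mul_sub]
    rw [Finset.sum_sub_distrib, ← Finset.sum_mul]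
    field_simp
    rfl
  rw [this, abs_div, abs_of_pos hS, div_le_iff₀ hS]
  refine (Finset.abs_sum_le_sum_abs _ _).trans ?_
  rw [mul_comm, Finset.sum_mul]
  refine Finset.sum_le_sum fun i _ => ?_
  rw [abs_mul, abs_of_nonneg (bump_nonneg _ _ _)]
  by_cases hi : bump r (z i) x = 0
  · simp [hi]
  · exact mul_le_mul_of_nonneg_left (h i (dist_lt_of_bump_ne_zero hr hi)) (bump_nonneg _ _ _)

lemma abs_bumpAverage_sub_le (hr : 0 < r) (hF : ∀ x i, dist x (z i) < 3 * r → i ∈ F x)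
    (hz : ∀ x, ∃ i, dist x (z i) < r) {N : ℝ} {x y : X} (hN : (F x).card ≤ N)
    (hxy : dist x y < r) {a M : ℝ} (h : ∀ i ∈ F x, |c i - a| ≤ M) :
    |bumpAverage r z c x - bumpAverage r z c y| ≤ 2 * N * (dist x y / r) * M := by
  have hx : dist x x < r := by simpa using hr
  have hSx := one_le_sum_bump hr hF hz hx
  have hSy := one_le_sum_bump hr hF hz hxy
  rw [bumpAverage_eq hr hF hx, bumpAverage_eq hr hF hxy]
  set S := ∑ i ∈ F x, bump r (z i) x
  set T := ∑ i ∈ F x, bump r (z i) y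
  have hS : 0 < S := by linarith
  have hT : 0 < T := by linarith
  have hd : 0 ≤ dist x y / r := by positivity
  have hM : 0 ≤ M := by
    obtain ⟨i, hi⟩ := hz x
    exact (abs_nonneg _).trans (h i (hF x i (by linarith)))
  set f := ∑ i ∈ F x, bump r (z i) x * (c i - a) with hf
  set g := ∑ i ∈ F x, bump r (z i) y * (c i - a) with hg
  have hf' : ∑ i ∈ F x, bump r (z i) x * c i = f + S * a := by
    rw [hf]
    simp_rw [mul_sub]
    rw [Finset.sum_sub_distrib, ← Finset.sum_mul]
    ring
  have hg' : ∑ i ∈ F x, bump r (z i) y * c i = g + T * a := by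
    rw [hg]
    simp_rw [mul_sub]
    rw [Finset.sum_sub_distrib, ← Finset.sum_mul]
    ring
  have hcard : ∑ _i ∈ F x, dist x y / r ≤ N * (dist x y / r) := by
    rw [Finset.sum_const, nsmul_eq_mul]
    gcongr
  have hfg : |f - g| ≤ N * (dist x y / r) * M := by
    rw [hf, hg, ← Finset.sum_sub_distrib]
    refine (Finset.abs_sum_le_sum_abs _ _).trans ?_
    refine le_trans ?_ (mul_le_mul_of_nonneg_right hcard hM)
    rw [Finset.sum_mul]
    refine Finset.sum_le_sum fun i hi => ?_
    rw [← sub_mul, abs_mul]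
    exact mul_le_mul (abs_bump_sub_le hr _ _ _) (h i hi) (abs_nonneg _) hd
  have hST : |T - S| ≤ N * (dist x y / r) := by
    rw [← Finset.sum_sub_distrib]
    refine (Finset.abs_sum_le_sum_abs _ _).trans (le_trans ?_ hcard)
    refine Finset.sum_le_sum fun i _ => ?_
    rw [abs_sub_comm]
    exact abs_bump_sub_le hr _ _ _
  have hgT : |g| ≤ M * T := by
    rw [hg, mul_comm, Finset.sum_mul]
    refine (Finset.abs_sum_le_sum_abs _ _).trans (Finset.sum_le_sum fun i hi => ?_)
    rw [abs_mul, abs_of_nonneg (bump_nonneg _ _ _)]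
    exact mul_le_mul_of_nonneg_left (h i hi) (bump_nonneg _ _ _)
  -- Subtracting the constant `a` from the values first leaves only differences bounded by `M`.
  have key : (f + S * a) / S - (g + T * a) / T = (f - g) / S + g / T * ((T - S) / S) := by
    field_simp
    ring
  rw [hf', hg', key]
  refine (abs_add_le _ _).trans ?_
  have h1 : |(f - g) / S| ≤ N * (dist x y / r) * M := by
    rw [abs_div, abs_of_pos hS]
    exact (div_le_self (abs_nonneg _) hSx).trans hfg
  have h2 : |g / T * ((T - S) / S)| ≤ M * (N * (dist x y / r)) := by
    rw [abs_mul, abs_div, abs_div, abs_of_pos hS, abs_of_pos hT]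
    refine mul_le_mul ?_ ?_ (by positivity) hM
    · rwa [div_le_iff₀ hT]
    · exact (div_le_self (abs_nonneg _) hSx).trans hST
  linarith

lemma continuous_bumpAverage (hr : 0 < r) (hF : ∀ x i, dist x (z i) < 3 * r → i ∈ F x)
    (hz : ∀ x, ∃ i, dist x (z i) < r) : Continuous (bumpAverage r z c) := by
  rw [continuous_iff_continuousAt]
  intro x
  have hMi : ∀ i ∈ F x, |c i - 0| ≤ ∑ j ∈ F x, |c j - 0| := fun i hi =>
    Finset.single_le_sum (f := fun j => |c j - 0|) (fun _ _ => abs_nonneg _) hi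
  have hlim : Filter.Tendsto
      (fun y => 2 * ((F x).card : ℝ) * (dist x y / r) * ∑ j ∈ F x, |c j - 0|)
      (nhds x) (nhds 0) := by
    have : Continuous fun y =>
        2 * ((F x).card : ℝ) * (dist x y / r) * ∑ j ∈ F x, |c j - 0| := by fun_prop
    simpa using this.tendsto x
  rw [ContinuousAt, tendsto_iff_dist_tendsto_zero]
  refine squeeze_zero' (Filter.Eventually.of_forall fun _ => dist_nonneg) ?_ hlim
  filter_upwards [Metric.ball_mem_nhds x hr] with y hy
  rw [dist_comm, Real.dist_eq]
  exact abs_bumpAverage_sub_le hr hF hz le_rfl (by rwa [dist_comm]) hMi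

end Average

/-! ### Nets in doubling spaces -/

section Net

variable {X : Type*} [MetricSpace X]

lemma exists_maximal_separated {r : ℝ} (hr : 0 < r) : ∃ S : Set X,
    (∀ x ∈ S, ∀ y ∈ S, x ≠ y → r ≤ dist x y) ∧ ∀ x, ∃ y ∈ S, dist x y < r := by
  obtain ⟨S, hS⟩ := zorn_subset {S : Set X | ∀ x ∈ S, ∀ y ∈ S, x ≠ y → r ≤ dist x y} <| by
    intro c hc hchain
    refine ⟨⋃₀ c, ?_, fun s hs => subset_sUnion_of_mem hs⟩
    rintro x ⟨s, hs, hxs⟩ y ⟨t, ht, hyt⟩ hxy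
    rcases hchain.total hs ht with h | h
    · exact hc ht x (h hxs) y hyt hxy
    · exact hc hs x hxs y (h hyt) hxy
  refine ⟨S, hS.prop, fun x => ?_⟩
  by_contra! h
  have hx : insert x S ⊆ S := by
    refine hS.le_of_ge ?_ (subset_insert x S)
    rintro a (rfl | ha) b (rfl | hb) hab
    · exact absurd rfl hab
    · exact h b hb
    · rw [dist_comm]
      exact h a ha
    · exact hS.prop a ha b hb hab
  have := h x (hx (mem_insert x S))
  rw [dist_self] at this
  linarith

lemma disjoint_ball_of_separated {r : ℝ} {S : Set X}
    (hS : ∀ x ∈ S, ∀ y ∈ S, x ≠ y → r ≤ dist x y) :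
    Pairwise (Function.onFun Disjoint fun i : S => Metric.ball (i : X) (r / 2)) := by
  intro i j hij
  refine Metric.ball_disjoint_ball ?_
  rw [add_halves]
  exact hS i i.2 j j.2 (fun h => hij (Subtype.ext h))

variable [MeasurableSpace X] {μ : Measure X}

lemma IsDoubling.exists_iterate (hμ : IsDoubling μ) : ∃ c : ℝ≥0, ∀ (n : ℕ) (x : X) (r : ℝ), 0 < r →
    μ (Metric.ball x (2 ^ n * r)) ≤ c ^ n * μ (Metric.ball x r) := by
  obtain ⟨c, hc⟩ := hμ.doubling
  refine ⟨c, fun n x r hr => ?_⟩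
  induction n with
  | zero => simp
  | succ n ih =>
    rw [pow_succ', mul_assoc, pow_succ', mul_assoc]
    exact (hc x _ (by positivity)).trans (by gcongr)

lemma IsDoubling.sigmaFinite (hμ : IsDoubling μ) : SigmaFinite μ := by
  rcases isEmpty_or_nonempty X with hX | ⟨⟨x₀⟩⟩
  · rw [Measure.eq_zero_of_isEmpty μ]
    infer_instance
  · refine ⟨⟨⟨fun n : ℕ => Metric.ball x₀ (n + 1), fun _ => trivial,
      fun n => hμ.ball_lt_top _ _ (by positivity), ?_⟩⟩⟩
    refine eq_univ_of_forall fun x => mem_iUnion.2 ?_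
    obtain ⟨n, hn⟩ := exists_nat_gt (dist x x₀)
    exact ⟨n, Metric.mem_ball.2 (by linarith)⟩

variable [BorelSpace X]

lemma IsDoubling.countable_of_separated (hμ : IsDoubling μ) {r : ℝ} (hr : 0 < r) {S : Set X}
    (hS : ∀ x ∈ S, ∀ y ∈ S, x ≠ y → r ≤ dist x y) : Countable S := by
  have := hμ.sigmaFinite
  have h := Measure.countable_meas_pos_of_disjoint_iUnion (μ := μ)
    (fun i : S => Metric.isOpen_ball.measurableSet) (disjoint_ball_of_separated hS)
  have huniv : {i : S | 0 < μ (Metric.ball (i : X) (r / 2))} = univ :=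
    eq_univ_of_forall fun i => hμ.ball_pos _ _ (by positivity)
  rw [huniv] at h
  exact countable_univ_iff.1 h

/-- A ball of radius `3r` contains a bounded number of points of an `r`-separated set. -/
lemma IsDoubling.exists_card_le (hμ : IsDoubling μ) : ∃ N : ℕ, ∀ (r : ℝ), 0 < r → ∀ S : Set X,
    (∀ x ∈ S, ∀ y ∈ S, x ≠ y → r ≤ dist x y) → ∀ x : X, ∃ F : Finset S,
      F.card ≤ N ∧ ∀ i : S, i ∈ F ↔ dist x i < 3 * r := by
  obtain ⟨c, hc⟩ := hμ.exists_iterate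
  obtain ⟨N, hN⟩ := exists_nat_ge (c ^ 4)
  refine ⟨N, fun r hr S hS x => ?_⟩
  have hcard : ∀ T : Finset S, (∀ i ∈ T, dist x i < 3 * r) → T.card ≤ N := by
    intro T hT
    have hpos := hμ.ball_pos x (4 * r) (by positivity)
    have hfin := hμ.ball_lt_top x (4 * r) (by positivity)
    have h1 : (T.card : ℝ≥0∞) * μ (Metric.ball x (4 * r)) ≤ N * μ (Metric.ball x (4 * r)) :=
      calc (T.card : ℝ≥0∞) * μ (Metric.ball x (4 * r))
          = ∑ _i ∈ T, μ (Metric.ball x (4 * r)) := by rw [Finset.sum_const, nsmul_eq_mul]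
        _ ≤ ∑ i ∈ T, c ^ 4 * μ (Metric.ball (i : X) (r / 2)) := by
          refine Finset.sum_le_sum fun i hi => ?_
          refine le_trans (measure_mono ?_) (hc 4 i (r / 2) (by positivity))
          refine Metric.ball_subset_ball' ?_
          have := hT i hi
          linarith
        _ = c ^ 4 * μ (⋃ i ∈ T, Metric.ball (i : X) (r / 2)) := by
          rw [← Finset.mul_sum, measure_biUnion_finset
            (fun i _ j _ hij => disjoint_ball_of_separated hS hij)
            (fun i _ => Metric.isOpen_ball.measurableSet)]
        _ ≤ N * μ (Metric.ball x (4 * r)) := by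
          refine mul_le_mul' (by exact_mod_cast hN) (measure_mono (iUnion₂_subset fun i hi => ?_))
          refine Metric.ball_subset_ball' ?_
          have := hT i hi
          rw [dist_comm] at this
          linarith
    have h2 := (ENNReal.mul_le_mul_iff_left hpos.ne' hfin.ne).1 h1
    exact_mod_cast h2
  have hfin : {i : S | dist x i < 3 * r}.Finite := by
    by_contra h
    obtain ⟨T, hT, hTc⟩ := Set.Infinite.exists_subset_card_eq h (N + 1)
    have := hcard T fun i hi => hT hi
    omega
  refine ⟨hfin.toFinset, hcard _ fun i hi => by simpa using hi, fun i => by simp⟩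

end Net

/-! ### `L^p` quasi-norms of nonnegative functions -/

section LpNorms

variable {X : Type*} [MeasurableSpace X] {μ : Measure X} {p : ℝ≥0∞}

lemma eLpNorm_ennreal_eq (hp₀ : 0 < p) (hp₁ : p < ∞) (g : X → ℝ≥0∞) :
    eLpNorm g p μ = (∫⁻ x, g x ^ p.toReal ∂μ) ^ (1 / p.toReal) := by
  simp [eLpNorm_eq_lintegral_rpow_enorm_toReal hp₀.ne' hp₁.ne]

lemma eLpNorm_const_mul_ennreal (hp₀ : 0 < p) (hp₁ : p < ∞) (c : ℝ≥0∞) {g : X → ℝ≥0∞}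
    (hg : Measurable g) : eLpNorm (fun x => c * g x) p μ = c * eLpNorm g p μ := by
  have hP : 0 < p.toReal := ENNReal.toReal_pos hp₀.ne' hp₁.ne
  simp only [eLpNorm_ennreal_eq hp₀ hp₁, ENNReal.mul_rpow_of_nonneg _ _ hP.le]
  rw [lintegral_const_mul _ (hg.pow_const _), ENNReal.mul_rpow_of_nonneg _ _ (by positivity),
    ← ENNReal.rpow_mul, mul_one_div_cancel hP.ne', ENNReal.rpow_one]

lemma eLpNorm_iSup_le (hp₀ : 0 < p) (hp₁ : p < ∞) {g : ℤ → X → ℝ≥0∞}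
    (hg : ∀ j, Measurable (g j)) :
    eLpNorm (fun x => ⨆ j, g j x) p μ ≤
      (∑' j, eLpNorm (g j) p μ ^ p.toReal) ^ (1 / p.toReal) := by
  have hP : 0 < p.toReal := ENNReal.toReal_pos hp₀.ne' hp₁.ne
  simp only [eLpNorm_ennreal_eq hp₀ hp₁, ← ENNReal.rpow_mul, one_div_mul_cancel hP.ne',
    ENNReal.rpow_one]
  gcongr
  rw [← lintegral_tsum fun j => ((hg j).pow_const _).aemeasurable]
  gcongr with x
  rw [← ENNReal.le_rpow_inv_iff hP]
  refine iSup_le fun j => ?_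
  rw [ENNReal.le_rpow_inv_iff hP]
  exact ENNReal.le_tsum (f := fun j => g j x ^ p.toReal) j

lemma exists_eLpNorm_add_le (μ : Measure X) (p : ℝ≥0∞) : ∃ C : ℝ≥0, 0 < C ∧
    (∀ f g : X → ℝ≥0∞, Measurable f → Measurable g →
      eLpNorm (fun x => f x + g x) p μ ≤ C * (eLpNorm f p μ + eLpNorm g p μ)) ∧
    ∀ f g : X →ₘ[μ] ℝ, lpNorm μ p (f + g) ≤ C * (lpNorm μ p f + lpNorm μ p g) := by
  have hC := (ENNReal.LpAddConst_lt_top p).ne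
  have hle : p.LpAddConst ≤ ((p.LpAddConst.toNNReal + 1 : ℝ≥0) : ℝ≥0∞) := by
    rw [ENNReal.coe_add, ENNReal.coe_toNNReal hC]
    exact le_self_add
  refine ⟨p.LpAddConst.toNNReal + 1, by positivity, fun f g hf hg => ?_, fun f g => ?_⟩
  · refine (eLpNorm_add_le' hf.aestronglyMeasurable hg.aestronglyMeasurable p).trans ?_
    gcongr
  · unfold lpNorm
    rw [eLpNorm_congr_ae (AEEqFun.coeFn_add f g)]
    refine (eLpNorm_add_le' f.aestronglyMeasurable g.aestronglyMeasurable p).trans ?_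
    gcongr

/-- A supremum of multiples of `g j`, the multipliers being dominated by a two-sided geometric
weight centred at `k`. -/
lemma exists_eLpNorm_iSup_mul_le (μ : Measure X) (hp₀ : 0 < p) (hp₁ : p < ∞) {ε : ℝ}
    (hε : 0 < ε) :
    ∃ C : ℝ≥0, 0 < C ∧ ∀ g : ℤ → X → ℝ≥0∞, (∀ j, Measurable (g j)) →
      ∀ (k : ℤ) (A B : ℝ≥0∞) (α : ℤ → ℝ≥0∞), (∀ j, A * α j ≤ B * geomWeight (2 * ε) (k - j)) →
        A * eLpNorm (fun x => ⨆ j, α j * g j x) p μ ≤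
          B * (C * ⨆ j, geomWeight ε (k - j) * eLpNorm (g j) p μ) := by
  have hP : 0 < p.toReal := ENNReal.toReal_pos hp₀.ne' hp₁.ne
  obtain ⟨C, hC, h⟩ := exists_tsum_geomWeight_rpow_le_iSup hP hε
  refine ⟨C, hC, fun g hg k A B α hα => ?_⟩
  have hg' : ∀ j, Measurable fun x => α j * g j x := fun j => (hg j).const_mul _
  rw [← eLpNorm_const_mul_ennreal hp₀ hp₁ _ (Measurable.iSup hg')]
  have hmul : (fun x => A * ⨆ j, α j * g j x) = fun x => ⨆ j, A * α j * g j x := by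
    funext x
    simp_rw [ENNReal.mul_iSup, mul_assoc]
  rw [hmul]
  refine (eLpNorm_iSup_le hp₀ hp₁ fun j => (hg j).const_mul _).trans ?_
  refine le_trans ?_ (mul_le_mul_right (h _ k) _)
  have hpull : B = (B ^ p.toReal) ^ (1 / p.toReal) := by
    rw [← ENNReal.rpow_mul, mul_one_div_cancel hP.ne', ENNReal.rpow_one]
  rw [hpull, ← ENNReal.mul_rpow_of_nonneg _ _ (by positivity), ← ENNReal.tsum_mul_left]
  gcongr with j
  rw [← ENNReal.mul_rpow_of_nonneg _ _ hP.le, eLpNorm_const_mul_ennreal hp₀ hp₁ _ (hg j),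
    ← mul_assoc]
  refine ENNReal.rpow_le_rpow ?_ hP.le
  exact mul_le_mul_left (hα j) _

end LpNorms

/-! ### Lipschitz approximation at a fixed scale -/

section Approximation

variable {X : Type*} [MetricSpace X] [MeasurableSpace X] [BorelSpace X] {μ : Measure X}

/-- If the oscillation of `u` at scale `r` is controlled by `G`, then `u` is approximated by a
function `v` that is Lipschitz at scale `r`, both the error and the local Lipschitz constant being
controlled in `L^P` by `G`. Here `v` is the bump average, over a maximal `r`-separated set, of
values of `u` at points `w i` close to the net points where `G^P` is at most its mean; no
integrability of `u` enters, so every exponent `P > 0` is allowed. -/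
lemma IsDoubling.exists_lipschitz_approx (hμ : IsDoubling μ) : ∃ C : ℝ≥0, 0 < C ∧
    ∀ (P : ℝ), 0 < P → ∀ (r : ℝ), 0 < r → ∀ (u : X → ℝ) (G : X → ℝ≥0∞), Measurable G →
    ∀ E : Set X, μ E = 0 →
    (∀ x ∉ E, ∀ y ∉ E, dist x y < 8 * r → ‖u x - u y‖ₑ ≤ G x + G y) →
    ∃ (v : X → ℝ) (H : X → ℝ≥0∞), Continuous v ∧ Measurable H ∧
      ∫⁻ x, H x ^ P ∂μ ≤ C * ∫⁻ x, G x ^ P ∂μ ∧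
      (∀ x ∉ E, ‖u x - v x‖ₑ ≤ G x + H x) ∧
      ∀ x y, dist x y < r → ENNReal.ofReal r * ‖v x - v y‖ₑ ≤ C * (edist x y * H x) := by
  obtain ⟨c, hc⟩ := hμ.exists_iterate
  obtain ⟨N, hN⟩ := hμ.exists_card_le
  refine ⟨c ^ 3 + 4 * N + 1, by positivity, ?_⟩
  intro P hP r hr u G hG E hE hu
  obtain ⟨S, hS, hcover⟩ := exists_maximal_separated (X := X) hr
  have hScount := hμ.countable_of_separated hr hS
  choose F hFcard hF using hN r hr S hS
  have hF' : ∀ x (i : S), dist x (i : X) < 3 * r → i ∈ F x := fun x i h => (hF x i).2 h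
  have hcover' : ∀ x, ∃ i : S, dist x (i : X) < r := fun x => by
    obtain ⟨y, hy, hxy⟩ := hcover x
    exact ⟨⟨y, hy⟩, hxy⟩
  -- The sample points avoid `E`, and `G` is at most its `L^P` mean there.
  have hw : ∀ i : S, ∃ w ∉ E, dist w (i : X) < r / 2 ∧
      μ (Metric.ball (i : X) (r / 2)) * G w ^ P ≤
        ∫⁻ x in Metric.ball (i : X) (r / 2), G x ^ P ∂μ := by
    intro i
    set B := Metric.ball (i : X) (r / 2) with hB
    have hpos : 0 < μ B := hμ.ball_pos _ _ (by positivity)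
    have hlt : μ B < ∞ := hμ.ball_lt_top _ _ (by positivity)
    have hfin : IsFiniteMeasure (μ.restrict B) := ⟨by simpa using hlt⟩
    have hnull : μ.restrict B (E ∪ Bᶜ) = 0 := by
      refine measure_union_null (Measure.absolutelyContinuous_of_le Measure.restrict_le_self hE) ?_
      rw [Measure.restrict_apply Metric.isOpen_ball.measurableSet.compl, compl_inter_self,
        measure_empty]
    obtain ⟨w, hw, hwle⟩ := exists_notMem_null_le_laverage
      (by simpa [Measure.restrict_eq_zero] using hpos.ne')
      (hG.pow_const P).aemeasurable hnull
    rw [mem_union, not_or, notMem_compl_iff] at hw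
    refine ⟨w, hw.1, hw.2, ?_⟩
    rw [setLAverage_eq, ENNReal.le_div_iff_mul_le (Or.inl hpos.ne') (Or.inl hlt.ne)] at hwle
    rwa [mul_comm]
  choose w hwE hwdist hwG using hw
  -- A supremum rather than a sum: its `P`-th power is at most the sum of the `P`-th powers, and
  -- the resulting integrals of `G ^ P` live on the disjoint balls of radius `r / 2`.
  set H : X → ℝ≥0∞ := fun x =>
    ⨆ i : S, (Metric.ball (i : X) (3 * r)).indicator (fun _ => G (w i)) x with hH
  have hGH : ∀ x (i : S), dist x (i : X) < 3 * r → G (w i) ≤ H x := fun x i hi => by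
    refine le_trans (le_of_eq ?_) (le_iSup (fun i : S =>
      (Metric.ball (i : X) (3 * r)).indicator (fun _ => G (w i)) x) i)
    rw [indicator_of_mem]
    exact hi
  refine ⟨bumpAverage r (fun i : S => (i : X)) fun i => u (w i), H,
    continuous_bumpAverage hr hF' hcover', ?_, ?_, ?_, ?_⟩
  · exact Measurable.iSup fun i => measurable_const.indicator Metric.isOpen_ball.measurableSet
  · calc ∫⁻ x, H x ^ P ∂μ
        ≤ ∫⁻ x, ∑' i : S,
            (Metric.ball (i : X) (3 * r)).indicator (fun _ => G (w i) ^ P) x ∂μ := by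
          gcongr with x
          rw [← ENNReal.le_rpow_inv_iff hP]
          refine iSup_le fun i => ?_
          rw [ENNReal.le_rpow_inv_iff hP]
          refine le_trans ?_ (ENNReal.le_tsum i)
          by_cases hx : x ∈ Metric.ball (i : X) (3 * r)
          · rw [indicator_of_mem hx, indicator_of_mem hx]
          · rw [indicator_of_notMem hx, ENNReal.zero_rpow_of_pos hP]
            exact zero_le
      _ = ∑' i : S, G (w i) ^ P * μ (Metric.ball (i : X) (3 * r)) := by
          rw [lintegral_tsum fun i =>
            (measurable_const.indicator Metric.isOpen_ball.measurableSet).aemeasurable]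
          congr 1 with i
          rw [lintegral_indicator_const Metric.isOpen_ball.measurableSet]
      _ ≤ ∑' i : S, c ^ 3 * ∫⁻ x in Metric.ball (i : X) (r / 2), G x ^ P ∂μ := by
          refine ENNReal.tsum_le_tsum fun i => ?_
          refine le_trans ?_ (mul_le_mul_right (hwG i) _)
          rw [← mul_assoc, mul_comm]
          gcongr
          refine le_trans (measure_mono (Metric.ball_subset_ball ?_))
            (hc 3 i (r / 2) (by positivity))
          linarith
      _ = c ^ 3 * ∫⁻ x in ⋃ i : S, Metric.ball (i : X) (r / 2), G x ^ P ∂μ := by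
          rw [ENNReal.tsum_mul_left, lintegral_iUnion
            (fun i => Metric.isOpen_ball.measurableSet) (disjoint_ball_of_separated hS)]
      _ ≤ _ := by
          gcongr
          · push_cast
            rw [add_assoc]
            exact le_self_add
          · exact Measure.restrict_le_self
  · intro x hx
    rcases eq_or_ne (G x + H x) ∞ with htop | htop
    · rw [htop]
      exact le_top
    rw [← ofReal_norm, ENNReal.ofReal_le_iff_le_toReal htop, Real.norm_eq_abs]
    refine abs_sub_bumpAverage_le hr hF' hcover' fun i hi => ?_
    rw [← Real.norm_eq_abs, ← ENNReal.ofReal_le_iff_le_toReal htop, ofReal_norm]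
    refine (hu x hx (w i) (hwE i) ?_).trans (by gcongr; exact hGH x i (by linarith))
    have := dist_triangle_right x (w i) (i : X)
    have := hwdist i
    linarith
  · intro x y hxy
    rcases eq_or_ne x y with rfl | hne
    · simp
    have hed : edist x y ≠ 0 := by simpa using hne
    rcases eq_or_ne (H x) ∞ with htop | htop
    · rw [htop, ENNReal.mul_top hed, ENNReal.mul_top (by simp)]
      exact le_top
    obtain ⟨i₀, hi₀⟩ := hcover' x
    have hM : ∀ i ∈ F x, |u (w i) - u (w i₀)| ≤ 2 * (H x).toReal := fun i hi => by
      have hi' := (hF x i).1 hi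
      have h2 : ENNReal.ofReal (2 * (H x).toReal) = H x + H x := by
        rw [ENNReal.ofReal_mul zero_le_two, ENNReal.ofReal_toReal htop, ENNReal.ofReal_ofNat,
          two_mul]
      rw [← ENNReal.ofReal_le_ofReal_iff (by positivity), h2, ← Real.norm_eq_abs, ofReal_norm]
      refine (hu _ (hwE i) _ (hwE i₀) ?_).trans
        (add_le_add (hGH x i hi') (hGH x i₀ (by linarith)))
      have h3 := dist_triangle4 (w i) (i : X) (i₀ : X) (w i₀)
      have h4 := dist_triangle_left (i : X) (i₀ : X) x
      have h5 := hwdist i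
      have h6 := hwdist i₀
      rw [dist_comm] at h6
      linarith
    have key := abs_bumpAverage_sub_le hr hF' hcover' (N := N)
      (by exact_mod_cast hFcard x) hxy hM
    rw [← ofReal_norm, Real.norm_eq_abs, ← ENNReal.ofReal_mul hr.le]
    calc _ ≤ ENNReal.ofReal (4 * N * (dist x y * (H x).toReal)) := by
          refine ENNReal.ofReal_le_ofReal ((mul_le_mul_of_nonneg_left key hr.le).trans_eq ?_)
          field_simp
          ring
      _ = 4 * N * (edist x y * H x) := by
          rw [ENNReal.ofReal_mul (by positivity), ENNReal.ofReal_mul dist_nonneg,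
            ENNReal.ofReal_toReal htop, ← edist_dist, ENNReal.ofReal_mul (by positivity),
            ENNReal.ofReal_natCast, ENNReal.ofReal_ofNat]
      _ ≤ _ := by
          gcongr
          push_cast
          rw [add_assoc, add_comm]
          refine le_trans ?_ le_self_add
          exact le_self_add

end Approximation

/-! ### The `K`-functional is controlled by fractional gradients -/

section Scales

variable {X : Type*} [MetricSpace X]

lemma exists_dyadic_scale {d : ℝ} (hd : 0 < d) :
    ∃ j : ℤ, (2 : ℝ) ^ (-j - 1) ≤ d ∧ d < (2 : ℝ) ^ (-j) := by
  obtain ⟨n, hn⟩ := exists_mem_Ico_zpow hd one_lt_two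
  refine ⟨-n - 1, ?_, ?_⟩
  · rw [show -(-n - 1) - 1 = n by ring]
    exact hn.1
  · rw [show -(-n - 1) = n + 1 by ring]
    exact hn.2

lemma edist_rpow_le {x y : X} {j : ℤ} {s : ℝ} (hs : 0 ≤ s) (h : dist x y ≤ (2 : ℝ) ^ (-j)) :
    edist x y ^ s ≤ 2 ^ (-(j : ℝ) * s) := by
  have h' := ENNReal.ofReal_le_ofReal h
  rw [← edist_dist, ofReal_two_zpow] at h'
  rw [ENNReal.rpow_mul]
  push_cast at h'
  gcongr

/-- At distances at least `2^{-j-1}`, the power `d^s` is at most a multiple of `d`. -/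
lemma edist_rpow_le_mul {x y : X} {j : ℤ} {s : ℝ} (hs₀ : 0 ≤ s) (hs₁ : s ≤ 1)
    (h : (2 : ℝ) ^ (-j - 1) ≤ dist x y) :
    edist x y ^ s ≤ edist x y * 2 ^ ((j + 1 : ℝ) * (1 - s)) := by
  have h' := ENNReal.ofReal_le_ofReal h
  rw [← edist_dist, ofReal_two_zpow] at h'
  push_cast at h'
  calc edist x y ^ s
      = edist x y ^ s * 2 ^ ((-(j : ℝ) - 1) * (1 - s)) * 2 ^ ((j + 1 : ℝ) * (1 - s)) := by
        rw [mul_assoc, ← two_rpow_add]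
        ring_nf
        simp
    _ ≤ edist x y ^ s * edist x y ^ (1 - s) * 2 ^ ((j + 1 : ℝ) * (1 - s)) := by
        rw [ENNReal.rpow_mul]
        have : 0 ≤ 1 - s := by linarith
        gcongr
    _ = _ := by
        rw [← ENNReal.rpow_add_of_nonneg _ _ hs₀ (by linarith)]
        simp

/-- The multipliers `2^{-js}`, `j ≥ k - 3`, of the oscillation at scale `2^{-k}`. The shift by `3`
makes room for distances up to `8 · 2^{-k}`. -/
def fineWeight (s : ℝ) (k j : ℤ) : ℝ≥0∞ := if k - 3 ≤ j then 2 ^ (-(j : ℝ) * s) else 0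

/-- The multipliers `2^{(j+1)(1-s)}`, `j ≤ k`, of the Lipschitz constant at scales above
`2^{-k}`. -/
def coarseWeight (s : ℝ) (k j : ℤ) : ℝ≥0∞ := if j ≤ k then 2 ^ ((j + 1 : ℝ) * (1 - s)) else 0

/-- The factor `2^6` absorbs the indices `k - 3 ≤ j < k`, which lie on the growing side of the
weight. -/
lemma fineWeight_le {s : ℝ} (hs₀ : 0 < s) (hs₁ : s < 1) (k j : ℤ) :
    2 ^ (k * s) * fineWeight s k j ≤
      2 ^ (6 : ℝ) * geomWeight (2 * (min s (1 - s) / 2)) (k - j) := by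
  unfold fineWeight
  split_ifs with h
  · rw [geomWeight, ← two_rpow_add, ← two_rpow_add]
    refine two_rpow_mono ?_
    have h' : (k : ℝ) - 3 ≤ j := by exact_mod_cast h
    have h1 := min_le_left s (1 - s)
    have h3 : 0 < min s (1 - s) := lt_min hs₀ (by linarith)
    push_cast
    rcases abs_cases ((k : ℝ) - j) with ⟨ha, hb⟩ | ⟨ha, hb⟩ <;> rw [ha] <;> nlinarith
  · simp

lemma coarseWeight_le {s : ℝ} (hs₀ : 0 < s) (hs₁ : s < 1) (k j : ℤ) :
    2 ^ (k * s) * 2 ^ (-(k : ℝ)) * coarseWeight s k j ≤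
      2 ^ (6 : ℝ) * geomWeight (2 * (min s (1 - s) / 2)) (k - j) := by
  unfold coarseWeight
  split_ifs with h
  · rw [geomWeight, ← two_rpow_add, ← two_rpow_add, ← two_rpow_add]
    refine two_rpow_mono ?_
    have h' : (j : ℝ) ≤ k := by exact_mod_cast h
    have h1 := min_le_right s (1 - s)
    push_cast
    rw [abs_of_nonneg (by linarith)]
    nlinarith
  · simp

/-- The oscillation at scale `2^{-k}` is controlled by the terms of finer index. -/
lemma enorm_sub_le_fine {s : ℝ} (hs : 0 < s) {u : X → ℝ}
    {g : ℤ → X → ℝ≥0∞} {E : Set X}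
    (h : ∀ k : ℤ, ∀ x ∉ E, ∀ y ∉ E, (2 : ℝ) ^ (-k - 1) ≤ dist x y → dist x y < (2 : ℝ) ^ (-k) →
      ‖u x - u y‖ₑ ≤ edist x y ^ s * (g k x + g k y)) (k : ℤ) {x y : X} (hx : x ∉ E) (hy : y ∉ E)
    (hxy : dist x y < 8 * (2 : ℝ) ^ (-k)) :
    ‖u x - u y‖ₑ ≤ (⨆ j, fineWeight s k j * g j x) + ⨆ j, fineWeight s k j * g j y := by
  rcases eq_or_ne x y with rfl | hne
  · simp
  obtain ⟨j, hj₁, hj₂⟩ := exists_dyadic_scale (dist_pos.2 hne)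
  have hkj : k - 3 ≤ j := by
    have : (2 : ℝ) ^ (-j - 1) < 2 ^ (-k + 3) := by
      refine (hj₁.trans_lt hxy).trans_eq ?_
      rw [zpow_add₀ two_ne_zero]
      norm_num
      ring
    have := (zpow_lt_zpow_iff_right₀ one_lt_two).1 this
    omega
  have hw : fineWeight s k j = 2 ^ (-(j : ℝ) * s) := if_pos hkj
  calc ‖u x - u y‖ₑ ≤ edist x y ^ s * (g j x + g j y) := h j x hx y hy hj₁ hj₂
    _ ≤ fineWeight s k j * (g j x + g j y) := by
      rw [hw]
      gcongr
      exact edist_rpow_le hs.le hj₂.le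
    _ = fineWeight s k j * g j x + fineWeight s k j * g j y := mul_add _ _ _
    _ ≤ _ := add_le_add (le_iSup (fun j => fineWeight s k j * g j x) j)
      (le_iSup (fun j => fineWeight s k j * g j y) j)

/-- The difference quotients at scales above `2^{-k}` are controlled by the terms of coarser
index. -/
lemma enorm_sub_le_coarse {s : ℝ} (hs₀ : 0 < s) (hs₁ : s < 1) {u : X → ℝ}
    {g : ℤ → X → ℝ≥0∞} {E : Set X}
    (h : ∀ k : ℤ, ∀ x ∉ E, ∀ y ∉ E, (2 : ℝ) ^ (-k - 1) ≤ dist x y → dist x y < (2 : ℝ) ^ (-k) →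
      ‖u x - u y‖ₑ ≤ edist x y ^ s * (g k x + g k y)) (k : ℤ) {x y : X} (hx : x ∉ E) (hy : y ∉ E)
    (hxy : (2 : ℝ) ^ (-k) ≤ dist x y) :
    ‖u x - u y‖ₑ ≤ edist x y *
      ((⨆ j, coarseWeight s k j * g j x) + ⨆ j, coarseWeight s k j * g j y) := by
  have hpos : 0 < dist x y := lt_of_lt_of_le (by positivity) hxy
  obtain ⟨j, hj₁, hj₂⟩ := exists_dyadic_scale hpos
  have hkj : j ≤ k := by
    have := (zpow_lt_zpow_iff_right₀ one_lt_two).1 (hxy.trans_lt hj₂)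
    omega
  have hw : coarseWeight s k j = 2 ^ ((j + 1 : ℝ) * (1 - s)) := if_pos hkj
  calc ‖u x - u y‖ₑ ≤ edist x y ^ s * (g j x + g j y) := h j x hx y hy hj₁ hj₂
    _ ≤ edist x y * coarseWeight s k j * (g j x + g j y) := by
      rw [hw]
      gcongr
      exact edist_rpow_le_mul hs₀.le hs₁.le hj₁
    _ = edist x y * (coarseWeight s k j * g j x + coarseWeight s k j * g j y) := by ring
    _ ≤ _ := by
      gcongr
      · exact le_iSup (fun j => coarseWeight s k j * g j x) j
      · exact le_iSup (fun j => coarseWeight s k j * g j y) j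

end Scales

section KUpper

variable {X : Type*} [MetricSpace X] [MeasurableSpace X] {μ : Measure X} {p : ℝ≥0∞}

/-- A function `v` that is Lipschitz at scale `r` and close to `u` has a `1`-gradient, built from
its Lipschitz constant below scale `r` and from the difference quotients of `u` above it. -/
lemma isGradient_of_approx {u v w : X → ℝ} {E : Set X} (hE : μ E = 0) (hvw : w =ᵐ[μ] v)
    {k : ℤ} {C : ℝ≥0} {G H L : X → ℝ≥0∞} (hG : Measurable G) (hH : Measurable H)
    (hL : Measurable L) (happrox : ∀ x ∉ E, ‖u x - v x‖ₑ ≤ G x + H x)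
    (hlip : ∀ x y, dist x y < (2 : ℝ) ^ (-k) →
      ENNReal.ofReal (2 ^ (-k)) * ‖v x - v y‖ₑ ≤ C * (edist x y * H x))
    (hu : ∀ x ∉ E, ∀ y ∉ E, (2 : ℝ) ^ (-k) ≤ dist x y →
      ‖u x - u y‖ₑ ≤ edist x y * (L x + L y)) :
    IsGradient μ 1 w fun x => 2 ^ (k : ℝ) * (C + 1) * (G x + H x) + L x := by
  refine ⟨((hG.add hH).const_mul _).add hL, E ∪ {x | w x ≠ v x}, measure_union_null hE hvw, ?_⟩
  intro x hx y hy
  rw [mem_union, not_or, mem_ofPred_eq, not_not] at hx hy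
  obtain ⟨hxE, hxv⟩ := hx
  obtain ⟨hyE, hyv⟩ := hy
  rw [hxv, hyv, ENNReal.rpow_one]
  have hscale : ENNReal.ofReal ((2 : ℝ) ^ (-k)) = 2 ^ (-(k : ℝ)) := by
    rw [ofReal_two_zpow]
    push_cast
    rfl
  have hone : (2 : ℝ≥0∞) ^ (k : ℝ) * 2 ^ (-(k : ℝ)) = 1 := by
    rw [← two_rpow_add]
    simp
  rcases lt_or_ge (dist x y) ((2 : ℝ) ^ (-k)) with hlt | hge
  · calc ‖v x - v y‖ₑ = 2 ^ (k : ℝ) * (2 ^ (-(k : ℝ)) * ‖v x - v y‖ₑ) := by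
          rw [← mul_assoc, hone, one_mul]
      _ ≤ 2 ^ (k : ℝ) * (C * (edist x y * H x)) := by
          rw [← hscale]
          exact mul_le_mul_right (hlip x y hlt) _
      _ = edist x y * (2 ^ (k : ℝ) * C * H x) := by ring
      _ ≤ _ := by
          gcongr
          refine le_trans ?_ (le_add_right (le_add_right le_rfl))
          gcongr
          · exact le_self_add
          · exact le_add_self
  · have hd : 1 ≤ edist x y * 2 ^ (k : ℝ) := by
      have := ENNReal.ofReal_le_ofReal hge
      rw [← edist_dist, hscale] at this
      rw [← hone, mul_comm]
      gcongr
    have htri : ‖v x - v y‖ₑ ≤ ‖u x - v x‖ₑ + ‖u x - u y‖ₑ + ‖u y - v y‖ₑ := by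
      have : v x - v y = -(u x - v x) + (u x - u y) + (u y - v y) := by ring
      rw [this]
      refine (enorm_add_le _ _).trans ?_
      gcongr
      refine (enorm_add_le _ _).trans ?_
      rw [enorm_neg]
    calc ‖v x - v y‖ₑ ≤ (G x + H x) + edist x y * (L x + L y) + (G y + H y) := by
          refine htri.trans ?_
          gcongr
          · exact happrox x hxE
          · exact hu x hxE y hyE hge
          · exact happrox y hyE
      _ = 1 * ((G x + H x) + (G y + H y)) + edist x y * (L x + L y) := by ring
      _ ≤ edist x y * 2 ^ (k : ℝ) * ((C + 1) * ((G x + H x) + (G y + H y))) +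
          edist x y * (L x + L y) := by
          gcongr
          exact le_mul_of_one_le_left zero_le le_add_self
      _ = _ := by ring

variable [BorelSpace X]

/-- The key estimate: `2^{ks} K(u, 2^{-k})` is dominated by a geometric convolution of the norms
of any fractional gradient. -/
lemma IsDoubling.exists_dyadicK_le (hμ : IsDoubling μ) {s : ℝ} (hs₀ : 0 < s) (hs₁ : s < 1)
    (hp₀ : 0 < p) (hp₁ : p < ∞) : ∃ C : ℝ≥0, 0 < C ∧ ∀ (u : X →ₘ[μ] ℝ) (g : ℤ → X → ℝ≥0∞),
      IsFractionalGradient μ s u g → ∀ k,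
        dyadicK (lpNorm μ p) (homHajlaszNorm μ 1 p) s u k ≤
          C * ⨆ j, geomWeight (min s (1 - s) / 2) (k - j) * eLpNorm (g j) p μ := by
  have hP : 0 < p.toReal := ENNReal.toReal_pos hp₀.ne' hp₁.ne
  set ε := min s (1 - s) / 2 with hεdef
  have hε : 0 < ε := half_pos (lt_min hs₀ (by linarith))
  obtain ⟨C₁, hC₁, happrox⟩ := hμ.exists_lipschitz_approx
  obtain ⟨C₂, hC₂, hadd, -⟩ := exists_eLpNorm_add_le μ p
  obtain ⟨C₀, hC₀, hsup⟩ := exists_eLpNorm_iSup_mul_le μ hp₀ hp₁ hε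
  obtain ⟨C₃, hC₃, hC₃eq⟩ : ∃ C₃ : ℝ≥0, 0 < C₃ ∧ (C₃ : ℝ≥0∞) = 2 ^ (6 : ℝ) * C₀ :=
    ⟨2 ^ (6 : ℝ) * C₀, by positivity, by
      rw [ENNReal.coe_mul, ENNReal.coe_rpow_of_nonneg _ (by norm_num), ENNReal.coe_ofNat]⟩
  set D : ℝ≥0 := C₂ * (1 + C₁ ^ (1 / p.toReal)) with hD
  refine ⟨(D + C₂ * ((C₁ + 1) * D)) * C₃ + C₂ * C₃, by positivity, ?_⟩
  rintro u g ⟨hgm, E, hE, hg⟩ k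
  set G : X → ℝ≥0∞ := fun x => ⨆ j, fineWeight s k j * g j x with hGdef
  set L : X → ℝ≥0∞ := fun x => ⨆ j, coarseWeight s k j * g j x with hLdef
  have hG : Measurable G := Measurable.iSup fun j => (hgm j).const_mul _
  have hL : Measurable L := Measurable.iSup fun j => (hgm j).const_mul _
  set S := ⨆ j, geomWeight ε (k - j) * eLpNorm (g j) p μ
  have hGS : 2 ^ (k * s) * eLpNorm G p μ ≤ C₃ * S :=
    (hsup g hgm k _ _ _ fun j => fineWeight_le hs₀ hs₁ k j).trans_eq (by rw [hC₃eq, mul_assoc])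
  have hLS : 2 ^ (k * s) * 2 ^ (-(k : ℝ)) * eLpNorm L p μ ≤ C₃ * S :=
    (hsup g hgm k _ _ _ fun j => coarseWeight_le hs₀ hs₁ k j).trans_eq (by rw [hC₃eq, mul_assoc])
  obtain ⟨v, H, hv, hH, hHG, huv, hvlip⟩ := happrox p.toReal hP ((2 : ℝ) ^ (-k)) (by positivity)
    u G hG E hE fun x hx y hy hxy => enorm_sub_le_fine hs₀ hg k hx hy hxy
  have hGH : eLpNorm (fun x => G x + H x) p μ ≤ D * eLpNorm G p μ := by
    have hHn : eLpNorm H p μ ≤ (C₁ ^ (1 / p.toReal) : ℝ≥0) * eLpNorm G p μ := by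
      rw [eLpNorm_ennreal_eq hp₀ hp₁, eLpNorm_ennreal_eq hp₀ hp₁,
        ENNReal.coe_rpow_of_nonneg _ (by positivity),
        ← ENNReal.mul_rpow_of_nonneg _ _ (by positivity)]
      gcongr
    calc _ ≤ C₂ * (eLpNorm G p μ + eLpNorm H p μ) := hadd G H hG hH
      _ ≤ C₂ * (eLpNorm G p μ + (C₁ ^ (1 / p.toReal) : ℝ≥0) * eLpNorm G p μ) := by gcongr
      _ = _ := by
        rw [hD]
        push_cast
        ring
  set V : X →ₘ[μ] ℝ := AEEqFun.mk v hv.measurable.aestronglyMeasurable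
  have hVv : V =ᵐ[μ] v := AEEqFun.coeFn_mk _ _
  have hgrad := isGradient_of_approx hE hVv hG hH hL huv hvlip fun x hx y hy hxy =>
    enorm_sub_le_coarse hs₀ hs₁ hg k hx hy hxy
  have h₀ : lpNorm μ p (u - V) ≤ D * eLpNorm G p μ := by
    refine le_trans ?_ hGH
    refine eLpNorm_mono_enorm_ae ?_
    filter_upwards [AEEqFun.coeFn_sub u V, hVv, compl_mem_ae_iff.2 hE] with x hx hx' hxE
    rw [hx, Pi.sub_apply, hx', enorm_eq_self]
    exact huv x hxE
  have h₁ : homHajlaszNorm μ 1 p V ≤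
      C₂ * (2 ^ (k : ℝ) * (C₁ + 1) * (D * eLpNorm G p μ) + eLpNorm L p μ) := by
    refine (iInf₂_le _ hgrad).trans ?_
    refine (hadd _ L ((hG.add hH).const_mul _) hL).trans ?_
    rw [eLpNorm_const_mul_ennreal hp₀ hp₁ _ (hG.add hH)]
    gcongr
    exact hGH
  have hscale : ENNReal.ofReal ((2 : ℝ) ^ (-k)) = 2 ^ (-(k : ℝ)) := by
    rw [ofReal_two_zpow]
    push_cast
    rfl
  have hone : (2 : ℝ≥0∞) ^ (-(k : ℝ)) * 2 ^ (k : ℝ) = 1 := by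
    rw [← two_rpow_add]
    simp
  calc dyadicK (lpNorm μ p) (homHajlaszNorm μ 1 p) s u k
      ≤ 2 ^ (k * s) * (D * eLpNorm G p μ + 2 ^ (-(k : ℝ)) *
          (C₂ * (2 ^ (k : ℝ) * (C₁ + 1) * (D * eLpNorm G p μ) + eLpNorm L p μ))) := by
        unfold dyadicK
        gcongr
        refine (iInf_le_of_le (u - V) (iInf₂_le V (sub_add_cancel u V).symm)).trans ?_
        rw [hscale]
        gcongr
    _ = (D + C₂ * ((2 ^ (-(k : ℝ)) * 2 ^ (k : ℝ)) * (C₁ + 1) * D)) *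
          (2 ^ (k * s) * eLpNorm G p μ) +
          C₂ * (2 ^ (k * s) * 2 ^ (-(k : ℝ)) * eLpNorm L p μ) := by ring
    _ ≤ (D + C₂ * (1 * (C₁ + 1) * D)) * (C₃ * S) + C₂ * (C₃ * S) := by
        rw [hone]
        gcongr
    _ = _ := by
        push_cast
        ring

end KUpper

/-! ### Fractional gradients from the `K`-functional -/

section KLower

variable {X : Type*} [MetricSpace X] [MeasurableSpace X] {μ : Measure X} {p q : ℝ≥0∞}

/-- Decompositions `u = f₀ k + f₁ k`, one for each scale `2^{-k}`, yield a fractional gradient. -/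
lemma isFractionalGradient_of_decomposition {s : ℝ} (hs₀ : 0 < s) (hs₁ : s < 1) {u : X →ₘ[μ] ℝ}
    {f₀ f₁ : ℤ → X →ₘ[μ] ℝ} {h : ℤ → X → ℝ≥0∞} (hu : ∀ k, u = f₀ k + f₁ k)
    (hh : ∀ k, IsGradient μ 1 (f₁ k) (h k)) :
    IsFractionalGradient μ s u fun k x =>
      2 ^ (k * s) * 2 ^ s * (‖f₀ k x‖ₑ + 2 ^ (-(k : ℝ)) * h k x) := by
  have hm : ∀ k, Measurable fun x => ‖f₀ k x‖ₑ := fun k => (f₀ k).measurable.enorm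
  choose hhm E hE hgrad using hh
  refine ⟨fun k => ((hm k).add ((hhm k).const_mul _)).const_mul _,
    (⋃ k, E k) ∪ ⋃ k, {x | u x ≠ f₀ k x + f₁ k x}, ?_, ?_⟩
  · refine measure_union_null (measure_iUnion_null hE) (measure_iUnion_null fun k => ?_)
    have h1 : u =ᵐ[μ] fun x => f₀ k x + f₁ k x := by
      conv_lhs => rw [hu k]
      exact AEEqFun.coeFn_add _ _
    exact h1
  · intro k x hx y hy hd₁ hd₂
    simp only [mem_union, mem_iUnion, not_or, not_exists, mem_ofPred_eq, not_not] at hx hy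
    rw [hx.2 k, hy.2 k]
    have hlow : 1 ≤ 2 ^ (k * s) * 2 ^ s * edist x y ^ s := by
      have h' := ENNReal.ofReal_le_ofReal hd₁
      rw [← edist_dist, ofReal_two_zpow] at h'
      push_cast at h'
      calc (1 : ℝ≥0∞) = 2 ^ (k * s) * 2 ^ s * (2 ^ (-(k : ℝ) - 1)) ^ s := by
            rw [← ENNReal.rpow_mul, ← two_rpow_add, ← two_rpow_add]
            ring_nf
            simp
        _ ≤ _ := by gcongr
    have hhigh : edist x y ≤ 2 ^ (k * s) * 2 ^ s * edist x y ^ s * 2 ^ (-(k : ℝ)) := by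
      have h' := edist_rpow_le (s := 1 - s) (by linarith) hd₂.le
      calc edist x y = edist x y ^ s * edist x y ^ (1 - s) := by
            rw [← ENNReal.rpow_add_of_nonneg _ _ hs₀.le (by linarith)]
            simp
        _ ≤ edist x y ^ s * (2 ^ (k * s) * 2 ^ s * 2 ^ (-(k : ℝ))) := by
            gcongr
            refine h'.trans ?_
            rw [← two_rpow_add, ← two_rpow_add]
            refine two_rpow_mono ?_
            nlinarith
        _ = _ := by ring
    set A := (2 : ℝ≥0∞) ^ (k * s) * 2 ^ s * edist x y ^ s with hA
    have hgr := hgrad k x (hx.1 k) y (hy.1 k)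
    rw [ENNReal.rpow_one] at hgr
    calc ‖f₀ k x + f₁ k x - (f₀ k y + f₁ k y)‖ₑ
        = ‖(f₀ k x - f₀ k y) + (f₁ k x - f₁ k y)‖ₑ := by congr 1; ring
      _ ≤ ‖f₀ k x - f₀ k y‖ₑ + ‖f₁ k x - f₁ k y‖ₑ := enorm_add_le _ _
      _ ≤ 1 * (‖f₀ k x‖ₑ + ‖f₀ k y‖ₑ) + edist x y * (h k x + h k y) := by
          rw [one_mul]
          exact add_le_add (enorm_sub_le) hgr
      _ ≤ A * (‖f₀ k x‖ₑ + ‖f₀ k y‖ₑ) + A * 2 ^ (-(k : ℝ)) * (h k x + h k y) := by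
          gcongr
      _ = _ := by
          rw [hA]
          ring

lemma exists_decomposition_lt {u : X →ₘ[μ] ℝ} {t : ℝ} (ht : 0 < t) {b : ℝ≥0∞}
    (hb : KFunctional (lpNorm μ p) (homHajlaszNorm μ 1 p) u t < b) :
    ∃ (f₀ f₁ : X →ₘ[μ] ℝ) (h : X → ℝ≥0∞), u = f₀ + f₁ ∧ IsGradient μ 1 f₁ h ∧
      lpNorm μ p f₀ + ENNReal.ofReal t * eLpNorm h p μ < b := by
  simp only [KFunctional, iInf_lt_iff] at hb
  obtain ⟨f₀, f₁, hu, hlt⟩ := hb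
  have ht₀ : ENNReal.ofReal t ≠ 0 := by simpa using ht
  rw [homHajlaszNorm, ENNReal.mul_iInf_of_ne ht₀ ENNReal.ofReal_ne_top, ENNReal.add_iInf,
    iInf_lt_iff] at hlt
  obtain ⟨h, hlt⟩ := hlt
  rw [ENNReal.mul_iInf_of_ne ht₀ ENNReal.ofReal_ne_top] at hlt
  by_cases hh : IsGradient μ 1 f₁ h
  · refine ⟨f₀, f₁, h, hu, hh, ?_⟩
    simpa only [hh, iInf_pos] using hlt
  · simp [hh] at hlt

lemma exists_homBesovNorm_le_seqNorm (hq₀ : 0 < q) {s : ℝ} (hs₀ : 0 < s) (hs₁ : s < 1)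
    (hp₀ : 0 < p) (hp₁ : p < ∞) : ∃ C : ℝ≥0, 0 < C ∧ ∀ u : X →ₘ[μ] ℝ,
      homBesovNorm μ s p q u ≤
        C * seqNorm q (dyadicK (lpNorm μ p) (homHajlaszNorm μ 1 p) s u) := by
  obtain ⟨C₁, hC₁, hadd, -⟩ := exists_eLpNorm_add_le μ p
  obtain ⟨C₂, hC₂, hseq⟩ := exists_seqNorm_add_le hq₀
  obtain ⟨C₃, hC₃, hgeom⟩ := exists_seqNorm_geomWeight_le hq₀ one_pos
  refine ⟨2 ^ s * C₁ * C₂, by positivity, fun u => ?_⟩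
  set K := dyadicK (lpNorm μ p) (homHajlaszNorm μ 1 p) s u with hK
  rcases eq_or_ne (seqNorm q K) ∞ with htop | htop
  · rw [htop, ENNReal.mul_top (by
      rw [ENNReal.coe_ne_zero]
      positivity)]
    exact le_top
  have hKtop : ∀ k, K k ≠ ∞ := fun k => ne_top_of_le_ne_top htop (le_seqNorm hq₀ K k)
  -- The decompositions are optimal only up to errors whose sequence norm is at most `C₃ δ`.
  have key : ∀ δ : ℝ≥0, 0 < δ → homBesovNorm μ s p q u ≤
      (2 ^ s * C₁ * C₂ : ℝ≥0) * (seqNorm q K + δ * C₃) := by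
    intro δ hδ
    have hdec : ∀ k : ℤ, ∃ (f₀ f₁ : X →ₘ[μ] ℝ) (h : X → ℝ≥0∞), u = f₀ + f₁ ∧
        IsGradient μ 1 f₁ h ∧ 2 ^ (k * s) * (lpNorm μ p f₀ + 2 ^ (-(k : ℝ)) * eLpNorm h p μ) ≤
          K k + δ * geomWeight 1 k := by
      intro k
      have hpos : 0 < (δ : ℝ≥0∞) * geomWeight 1 k :=
        ENNReal.mul_pos (by simpa using hδ.ne') (two_rpow_ne_zero _)
      have hlt : K k < K k + δ * geomWeight 1 k := ENNReal.lt_add_right (hKtop k) hpos.ne'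
      have hlt' : KFunctional (lpNorm μ p) (homHajlaszNorm μ 1 p) u ((2 : ℝ) ^ (-k)) <
          (K k + δ * geomWeight 1 k) / 2 ^ (k * s) := by
        rw [ENNReal.lt_div_iff_mul_lt (Or.inl (two_rpow_ne_zero _)) (Or.inl (two_rpow_ne_top _)),
          mul_comm]
        exact hlt
      obtain ⟨f₀, f₁, h, hu, hh, hb⟩ := exists_decomposition_lt (by positivity) hlt'
      refine ⟨f₀, f₁, h, hu, hh, ?_⟩
      rw [ENNReal.lt_div_iff_mul_lt (Or.inl (two_rpow_ne_zero _)) (Or.inl (two_rpow_ne_top _)),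
        mul_comm, ofReal_two_zpow] at hb
      push_cast at hb
      exact hb.le
    choose f₀ f₁ h hu hh hb using hdec
    refine (iInf₂_le _ (isFractionalGradient_of_decomposition hs₀ hs₁ hu hh)).trans ?_
    have hterm : ∀ k : ℤ, eLpNorm (fun x => 2 ^ (k * s) * 2 ^ s *
        (‖f₀ k x‖ₑ + 2 ^ (-(k : ℝ)) * h k x)) p μ ≤
          2 ^ s * C₁ * (K k + δ * geomWeight 1 k) := by
      intro k
      have hm : Measurable fun x => ‖f₀ k x‖ₑ := (f₀ k).measurable.enorm
      have hm' : Measurable fun x => 2 ^ (-(k : ℝ)) * h k x := (hh k).1.const_mul _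
      have hm'' : Measurable fun x => ‖f₀ k x‖ₑ + 2 ^ (-(k : ℝ)) * h k x := hm.add hm'
      rw [eLpNorm_const_mul_ennreal hp₀ hp₁ _ hm'']
      calc _ ≤ 2 ^ (k * s) * 2 ^ s * (C₁ * (lpNorm μ p (f₀ k) +
              2 ^ (-(k : ℝ)) * eLpNorm (h k) p μ)) := by
            gcongr
            refine (hadd _ _ hm hm').trans ?_
            rw [eLpNorm_const_mul_ennreal hp₀ hp₁ _ (hh k).1, eLpNorm_enorm]
            rfl
        _ = 2 ^ s * C₁ * (2 ^ (k * s) * (lpNorm μ p (f₀ k) +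
              2 ^ (-(k : ℝ)) * eLpNorm (h k) p μ)) := by ring
        _ ≤ _ := by
            gcongr
            exact hb k
    calc _ ≤ seqNorm q fun k => 2 ^ s * C₁ * (K k + δ * geomWeight 1 k) := seqNorm_mono hterm
      _ ≤ 2 ^ s * C₁ * (C₂ * (seqNorm q K + δ * C₃)) := by
          rw [seqNorm_const_mul hq₀]
          gcongr
          refine (hseq _ _).trans ?_
          rw [seqNorm_const_mul hq₀]
          gcongr
      _ = _ := by
          rw [ENNReal.coe_mul, ENNReal.coe_mul, ENNReal.coe_rpow_of_nonneg _ hs₀.le,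
            ENNReal.coe_ofNat, mul_assoc, mul_assoc, mul_assoc]
  refine ENNReal.le_of_forall_pos_le_add fun η hη _ => ?_
  set D : ℝ≥0 := 2 ^ s * C₁ * C₂ with hD
  have hDpos : 0 < D := by positivity
  refine (key (η / (D * C₃)) (by positivity)).trans (le_of_eq ?_)
  rw [mul_add]
  congr 1
  rw [← ENNReal.coe_mul, ← ENNReal.coe_mul]
  congr 1
  field_simp

end KLower

/-! ### Comparison of the norms -/

section Comparison

lemma finite_iff_of_equiv {A : Type*} {N M : A → ℝ≥0∞} {C : ℝ≥0} {f : A}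
    (h₁ : N f ≤ C * M f) (h₂ : M f ≤ C * N f) : N f < ∞ ↔ M f < ∞ :=
  ⟨fun h => h₂.trans_lt (ENNReal.mul_lt_top ENNReal.coe_lt_top h),
    fun h => h₁.trans_lt (ENNReal.mul_lt_top ENNReal.coe_lt_top h)⟩

variable {X : Type*} [MetricSpace X] [MeasurableSpace X] {μ : Measure X} {p q : ℝ≥0∞}

lemma homHajlaszNorm_zero (μ : Measure X) (p : ℝ≥0∞) : homHajlaszNorm μ 1 p 0 = 0 := by
  have h : IsGradient μ 1 ((0 : X →ₘ[μ] ℝ) : X → ℝ) fun _ => 0 := by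
    refine ⟨measurable_const, {x | (0 : X →ₘ[μ] ℝ) x ≠ 0}, ?_, fun x hx y hy => ?_⟩
    · exact AEEqFun.coeFn_zero (μ := μ) (β := ℝ)
    · rw [mem_ofPred_eq, not_not] at hx hy
      simp [hx, hy]
  have := iInf₂_le (f := fun g (_ : IsGradient μ 1 ((0 : X →ₘ[μ] ℝ) : X → ℝ) g) =>
    eLpNorm g p μ) _ h
  exact le_antisymm (this.trans_eq eLpNorm_zero') zero_le

/-- Passing to the inhomogeneous space adds to the `K`-functional at most a multiple of
`min(1,t) ‖u‖_p`. -/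
lemma exists_dyadicK_hajlaszNorm_le (μ : Measure X) (p : ℝ≥0∞) {s : ℝ} (hs₀ : 0 < s)
    (hs₁ : s < 1) : ∃ C : ℝ≥0, 0 < C ∧ ∀ (u : X →ₘ[μ] ℝ) (k : ℤ),
      dyadicK (lpNorm μ p) (hajlaszNorm μ 1 p) s u k ≤
        C * (dyadicK (lpNorm μ p) (homHajlaszNorm μ 1 p) s u k +
          lpNorm μ p u * geomWeight (min s (1 - s)) k) := by
  obtain ⟨C, hC, -, hadd⟩ := exists_eLpNorm_add_le μ p
  refine ⟨1 + C, by positivity, fun u k => ?_⟩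
  have hscale : ENNReal.ofReal ((2 : ℝ) ^ (-k)) = 2 ^ (-(k : ℝ)) := by
    rw [ofReal_two_zpow]
    push_cast
    rfl
  rcases le_or_gt 0 k with hk | hk
  · have hk' : (0 : ℝ) ≤ k := by exact_mod_cast hk
    have ht : (2 : ℝ≥0∞) ^ (-(k : ℝ)) ≤ 1 := by
      simpa using two_rpow_mono (neg_nonpos.2 hk')
    have hK : KFunctional (lpNorm μ p) (hajlaszNorm μ 1 p) u ((2 : ℝ) ^ (-k)) ≤
        (1 + C) * (KFunctional (lpNorm μ p) (homHajlaszNorm μ 1 p) u ((2 : ℝ) ^ (-k)) +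
          2 ^ (-(k : ℝ)) * lpNorm μ p u) := by
      have h₀ : (1 + C : ℝ≥0∞) ≠ 0 := by simp
      have h₁ : (1 + C : ℝ≥0∞) ≠ ∞ := by simp
      rw [mul_add]
      conv_rhs => rw [KFunctional]
      simp only [ENNReal.mul_iInf_of_ne h₀ h₁, ENNReal.iInf_add]
      refine le_iInf fun f₀ => le_iInf fun f₁ => le_iInf fun hu => ?_
      refine (iInf_le_of_le f₀ (iInf₂_le f₁ hu)).trans ?_
      have hf₁ : lpNorm μ p f₁ ≤ C * (lpNorm μ p u + lpNorm μ p f₀) := by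
        have : f₁ = u + -f₀ := by rw [hu]; abel
        have hneg : lpNorm μ p (-f₀) = lpNorm μ p f₀ := by
          unfold lpNorm
          rw [eLpNorm_congr_ae (AEEqFun.coeFn_neg f₀), eLpNorm_neg]
        rw [← hneg]
        conv_lhs => rw [this]
        exact hadd _ _
      rw [hscale, hajlaszNorm]
      set t := (2 : ℝ≥0∞) ^ (-(k : ℝ))
      set a := lpNorm μ p f₀
      set b := homHajlaszNorm μ 1 p f₁
      set c := lpNorm μ p u
      calc a + t * (lpNorm μ p f₁ + b) ≤ a + t * (C * (c + a) + b) := by gcongr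
        _ = a + C * (t * a) + t * b + C * (t * c) := by ring
        _ ≤ a + C * (1 * a) + (1 + C) * (t * b) + (1 + C) * (t * c) := by
            have hb : t * b ≤ (1 + C) * (t * b) := le_mul_of_one_le_left zero_le le_self_add
            have hCC : (C : ℝ≥0∞) ≤ 1 + C := le_add_self
            gcongr
        _ = _ := by ring
    calc dyadicK (lpNorm μ p) (hajlaszNorm μ 1 p) s u k
        ≤ 2 ^ (k * s) * ((1 + C) *
          (KFunctional (lpNorm μ p) (homHajlaszNorm μ 1 p) u ((2 : ℝ) ^ (-k)) +
            2 ^ (-(k : ℝ)) * lpNorm μ p u)) := mul_le_mul_right hK _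
      _ = (1 + C) * (dyadicK (lpNorm μ p) (homHajlaszNorm μ 1 p) s u k +
            lpNorm μ p u * (2 ^ (k * s) * 2 ^ (-(k : ℝ)))) := by
          rw [dyadicK]
          ring
      _ ≤ _ := by
          push_cast
          gcongr
          rw [← two_rpow_add, geomWeight, abs_of_nonneg hk']
          refine two_rpow_mono ?_
          have := min_le_right s (1 - s)
          nlinarith
  · have hk' : (k : ℝ) ≤ 0 := by exact_mod_cast hk.le
    have hK : KFunctional (lpNorm μ p) (hajlaszNorm μ 1 p) u ((2 : ℝ) ^ (-k)) ≤ lpNorm μ p u := by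
      refine (iInf_le_of_le u (iInf₂_le 0 (add_zero u).symm)).trans (le_of_eq ?_)
      have h0 : lpNorm μ p (0 : X →ₘ[μ] ℝ) = 0 := by
        unfold lpNorm
        rw [eLpNorm_congr_ae AEEqFun.coeFn_zero, eLpNorm_zero]
      rw [hajlaszNorm, homHajlaszNorm_zero, h0]
      simp
    calc dyadicK (lpNorm μ p) (hajlaszNorm μ 1 p) s u k
        ≤ 2 ^ (k * s) * lpNorm μ p u := mul_le_mul_right hK _
      _ ≤ geomWeight (min s (1 - s)) k * lpNorm μ p u := by
          gcongr
          rw [geomWeight, abs_of_nonpos hk']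
          refine two_rpow_mono ?_
          have := min_le_left s (1 - s)
          nlinarith
      _ = 1 * (lpNorm μ p u * geomWeight (min s (1 - s)) k) := by ring
      _ ≤ _ := by
          push_cast
          gcongr
          · exact le_self_add
          · exact le_add_self

lemma lpNorm_le_dyadicK_zero (μ : Measure X) (p : ℝ≥0∞) : ∃ C : ℝ≥0, 0 < C ∧
    ∀ (s : ℝ) (u : X →ₘ[μ] ℝ),
      lpNorm μ p u ≤ C * dyadicK (lpNorm μ p) (hajlaszNorm μ 1 p) s u 0 := by
  obtain ⟨C, hC, -, hadd⟩ := exists_eLpNorm_add_le μ p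
  refine ⟨C, hC, fun s u => ?_⟩
  have h₀ : (C : ℝ≥0∞) ≠ 0 := by simpa using hC.ne'
  simp only [dyadicK, KFunctional, Int.cast_zero, zero_mul, ENNReal.rpow_zero, one_mul, neg_zero,
    zpow_zero, ENNReal.ofReal_one, ENNReal.mul_iInf_of_ne h₀ ENNReal.coe_ne_top]
  refine le_iInf fun f₀ => le_iInf fun f₁ => le_iInf fun hu => ?_
  rw [hu]
  refine (hadd f₀ f₁).trans ?_
  gcongr
  exact le_self_add

lemma dyadicK_homHajlaszNorm_le (s : ℝ) (u : X →ₘ[μ] ℝ) (k : ℤ) :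
    dyadicK (lpNorm μ p) (homHajlaszNorm μ 1 p) s u k ≤
      dyadicK (lpNorm μ p) (hajlaszNorm μ 1 p) s u k := by
  unfold dyadicK KFunctional
  gcongr
  exact le_add_self

lemma besovSpace_eq (μ : Measure X) (s : ℝ) (p q : ℝ≥0∞) :
    besovSpace μ s p q = {f | besovNorm μ s p q f < ∞} := by
  ext f
  rw [besovSpace, homBesovSpace, finiteSpace, finiteSpace, mem_inter_iff, mem_ofPred_eq,
    mem_ofPred_eq, mem_ofPred_eq, besovNorm, ENNReal.add_lt_top, and_comm]

variable [BorelSpace X]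

lemma IsDoubling.exists_seqNorm_le_homBesovNorm (hμ : IsDoubling μ) (hq₀ : 0 < q) {s : ℝ}
    (hs₀ : 0 < s) (hs₁ : s < 1) (hp₀ : 0 < p) (hp₁ : p < ∞) : ∃ C : ℝ≥0, 0 < C ∧
      ∀ u : X →ₘ[μ] ℝ, seqNorm q (dyadicK (lpNorm μ p) (homHajlaszNorm μ 1 p) s u) ≤
        C * homBesovNorm μ s p q u := by
  have hε : 0 < min s (1 - s) / 2 := half_pos (lt_min hs₀ (by linarith))
  obtain ⟨C₁, hC₁, hK⟩ := hμ.exists_dyadicK_le hs₀ hs₁ hp₀ hp₁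
  obtain ⟨C₂, hC₂, hseq⟩ := exists_seqNorm_iSup_geomWeight_le hq₀ hε
  refine ⟨C₁ * C₂, by positivity, fun u => ?_⟩
  have h₀ : ((C₁ * C₂ : ℝ≥0) : ℝ≥0∞) ≠ 0 := by
    rw [ENNReal.coe_ne_zero]
    positivity
  rw [homBesovNorm, ENNReal.mul_iInf_of_ne h₀ ENNReal.coe_ne_top]
  refine le_iInf fun g => ?_
  rw [ENNReal.mul_iInf_of_ne h₀ ENNReal.coe_ne_top]
  refine le_iInf fun hg => ?_
  refine (seqNorm_mono (hK u g hg)).trans ?_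
  rw [seqNorm_const_mul hq₀, ENNReal.coe_mul, mul_assoc]
  gcongr
  exact hseq _

/-- The homogeneous Hajłasz–Besov norm is equivalent to the interpolation norm of
`(L^p, Ṁ^{1,p})`, as extended norms on all measurable functions. -/
lemma IsDoubling.homBesovNorm_equiv (hμ : IsDoubling μ) (hq₀ : 0 < q) {s : ℝ}
    (hs₀ : 0 < s) (hs₁ : s < 1) (hp₀ : 0 < p) (hp₁ : p < ∞) : ∃ C : ℝ≥0, 0 < C ∧
      ∀ u : X →ₘ[μ] ℝ,
        homBesovNorm μ s p q u ≤ C * interpNorm (lpNorm μ p) (homHajlaszNorm μ 1 p) s q u ∧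
        interpNorm (lpNorm μ p) (homHajlaszNorm μ 1 p) s q u ≤ C * homBesovNorm μ s p q u := by
  obtain ⟨C₁, hC₁, h₁⟩ := exists_seqNorm_dyadicK_le (N₀ := lpNorm μ p)
    (N₁ := homHajlaszNorm μ 1 p) hq₀ hs₀
  obtain ⟨C₂, hC₂, h₂⟩ := exists_interpNorm_le (N₀ := lpNorm μ p)
    (N₁ := homHajlaszNorm μ 1 p) hq₀ hs₀
  obtain ⟨C₃, hC₃, h₃⟩ := exists_homBesovNorm_le_seqNorm (μ := μ) hq₀ hs₀ hs₁ hp₀ hp₁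
  obtain ⟨C₄, hC₄, h₄⟩ := hμ.exists_seqNorm_le_homBesovNorm hq₀ hs₀ hs₁ hp₀ hp₁
  refine ⟨C₃ * C₁ + C₂ * C₄, by positivity, fun u => ⟨?_, ?_⟩⟩
  · calc _ ≤ C₃ * (C₁ * interpNorm (lpNorm μ p) (homHajlaszNorm μ 1 p) s q u) :=
          (h₃ u).trans (mul_le_mul_right (h₁ u) _)
      _ ≤ _ := by
          rw [← mul_assoc]
          push_cast
          gcongr
          exact le_self_add
  · calc _ ≤ C₂ * (C₄ * homBesovNorm μ s p q u) :=
          (h₂ u).trans (mul_le_mul_right (h₄ u) _)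
      _ ≤ _ := by
          rw [← mul_assoc]
          push_cast
          gcongr
          exact le_add_self

/-- The inhomogeneous Hajłasz–Besov norm is equivalent to the interpolation norm of
`(L^p, M^{1,p})`, as extended norms on all measurable functions. -/
lemma IsDoubling.besovNorm_equiv (hμ : IsDoubling μ) (hq₀ : 0 < q) {s : ℝ}
    (hs₀ : 0 < s) (hs₁ : s < 1) (hp₀ : 0 < p) (hp₁ : p < ∞) : ∃ C : ℝ≥0, 0 < C ∧
      ∀ u : X →ₘ[μ] ℝ,
        besovNorm μ s p q u ≤ C * interpNorm (lpNorm μ p) (hajlaszNorm μ 1 p) s q u ∧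
        interpNorm (lpNorm μ p) (hajlaszNorm μ 1 p) s q u ≤ C * besovNorm μ s p q u := by
  obtain ⟨C₁, hC₁, h₁⟩ := exists_seqNorm_dyadicK_le (N₀ := lpNorm μ p)
    (N₁ := hajlaszNorm μ 1 p) hq₀ hs₀
  obtain ⟨C₂, hC₂, h₂⟩ := exists_interpNorm_le (N₀ := lpNorm μ p)
    (N₁ := hajlaszNorm μ 1 p) hq₀ hs₀
  obtain ⟨C₃, hC₃, h₃⟩ := exists_homBesovNorm_le_seqNorm (μ := μ) hq₀ hs₀ hs₁ hp₀ hp₁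
  obtain ⟨C₄, hC₄, h₄⟩ := hμ.exists_seqNorm_le_homBesovNorm hq₀ hs₀ hs₁ hp₀ hp₁
  obtain ⟨C₅, hC₅, h₅⟩ := lpNorm_le_dyadicK_zero μ p
  obtain ⟨C₆, hC₆, h₆⟩ := exists_dyadicK_hajlaszNorm_le μ p hs₀ hs₁
  obtain ⟨C₇, hC₇, h₇⟩ := exists_seqNorm_add_le hq₀
  obtain ⟨C₈, hC₈, h₈⟩ := exists_seqNorm_geomWeight_le hq₀ (lt_min hs₀ (sub_pos.2 hs₁))
  refine ⟨(C₅ + C₃) * C₁ + C₂ * (C₆ * (C₇ * (C₄ + C₈))), by positivity, fun u => ⟨?_, ?_⟩⟩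
  · set I := interpNorm (lpNorm μ p) (hajlaszNorm μ 1 p) s q u
    have hlp : lpNorm μ p u ≤ C₅ * (C₁ * I) :=
      (h₅ s u).trans (mul_le_mul_right ((le_seqNorm hq₀ _ 0).trans (h₁ u)) _)
    have hhom : homBesovNorm μ s p q u ≤ C₃ * (C₁ * I) :=
      (h₃ u).trans (mul_le_mul_right
        ((seqNorm_mono (dyadicK_homHajlaszNorm_le s u)).trans (h₁ u)) _)
    calc besovNorm μ s p q u ≤ C₅ * (C₁ * I) + C₃ * (C₁ * I) := add_le_add hlp hhom
      _ = (C₅ + C₃) * C₁ * I := by ring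
      _ ≤ _ := by
          push_cast
          gcongr
          exact le_self_add
  · set a := lpNorm μ p u with ha
    set b := homBesovNorm μ s p q u
    have hseq : seqNorm q (dyadicK (lpNorm μ p) (hajlaszNorm μ 1 p) s u) ≤
        C₆ * (C₇ * (C₄ * b + a * C₈)) := by
      refine (seqNorm_mono (h₆ u)).trans ?_
      rw [seqNorm_const_mul hq₀]
      gcongr
      refine (h₇ _ _).trans ?_
      rw [seqNorm_const_mul hq₀]
      gcongr
      exact h₄ u
    calc _ ≤ C₂ * (C₆ * (C₇ * (C₄ * b + a * C₈))) := (h₂ u).trans (mul_le_mul_right hseq _)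
      _ ≤ C₂ * (C₆ * (C₇ * ((C₄ + C₈) * (a + b)))) := by
          gcongr
          calc C₄ * b + a * C₈ ≤ C₄ * (a + b) + (a + b) * C₈ := by
                gcongr
                · exact le_add_self
                · exact le_self_add
            _ = _ := by ring
      _ = C₂ * (C₆ * (C₇ * (C₄ + C₈))) * besovNorm μ s p q u := by
          rw [besovNorm]
          ring
      _ ≤ _ := by
          push_cast
          gcongr
          exact le_add_self

end Comparison

end HajlaszBesov

end

theorem mainTheorem4 {X : Type*} [MetricSpace X] [MeasurableSpace X] [BorelSpace X]
    (μ : Measure X) (hμ : HajlaszBesov.IsDoubling μ)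
    (s : ℝ) (hs₀ : 0 < s) (hs₁ : s < 1)
    (p q : ℝ≥0∞) (hp₀ : 0 < p) (hp₁ : p < ∞) (hq₀ : 0 < q) :
    (HajlaszBesov.homBesovSpace μ s p q =
        HajlaszBesov.interpSpace (HajlaszBesov.lpNorm μ p) (HajlaszBesov.homHajlaszNorm μ 1 p) s q ∧
      ∃ C : ℝ≥0, 0 < C ∧ ∀ f ∈ HajlaszBesov.homBesovSpace μ s p q,
        HajlaszBesov.homBesovNorm μ s p q f ≤ C * HajlaszBesov.interpNorm
          (HajlaszBesov.lpNorm μ p) (HajlaszBesov.homHajlaszNorm μ 1 p) s q f ∧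
        HajlaszBesov.interpNorm
          (HajlaszBesov.lpNorm μ p) (HajlaszBesov.homHajlaszNorm μ 1 p) s q f ≤
            C * HajlaszBesov.homBesovNorm μ s p q f) ∧
    (HajlaszBesov.besovSpace μ s p q =
        HajlaszBesov.interpSpace (HajlaszBesov.lpNorm μ p) (HajlaszBesov.hajlaszNorm μ 1 p) s q ∧
      ∃ C : ℝ≥0, 0 < C ∧ ∀ f ∈ HajlaszBesov.besovSpace μ s p q,
        HajlaszBesov.besovNorm μ s p q f ≤ C * HajlaszBesov.interpNorm
          (HajlaszBesov.lpNorm μ p) (HajlaszBesov.hajlaszNorm μ 1 p) s q f ∧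
        HajlaszBesov.interpNorm
          (HajlaszBesov.lpNorm μ p) (HajlaszBesov.hajlaszNorm μ 1 p) s q f ≤
            C * HajlaszBesov.besovNorm μ s p q f) := by
  obtain ⟨C, hC, h⟩ := hμ.homBesovNorm_equiv hq₀ hs₀ hs₁ hp₀ hp₁
  obtain ⟨C', hC', h'⟩ := hμ.besovNorm_equiv hq₀ hs₀ hs₁ hp₀ hp₁
  refine ⟨⟨?_, C, hC, fun f _ => h f⟩, ?_, C', hC', fun f _ => h' f⟩
  · rw [HajlaszBesov.interpSpace_eq hq₀ hs₀]
    ext f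
    exact HajlaszBesov.finite_iff_of_equiv (h f).1 (h f).2
  · rw [HajlaszBesov.interpSpace_eq hq₀ hs₀, HajlaszBesov.besovSpace_eq]
    ext f
    exact HajlaszBesov.finite_iff_of_equiv (h' f).1 (h' f).2
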